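/- Notation. Let $\mathsf V=\mathbb C^2$ with standard basis $v_{-1}=(1,0)^t$, $v_1=(0,1)^t$. For a subgroup $G\subseteq \mathsf{SU}_2$ acting diagonally on $\mathsf V^{\otimes k}$, let $\mathsf Z_k(G)=\mathrm{End}_G(\mathsf V^{\otimes k})$, a unital $\mathbb C$-algebra. For $j\le N$ regard $\mathrm{End}(\mathsf V^{\otimes j})\subseteq \mathrm{End}(\mathsf V^{\otimes N})$ through $a\mapsto a\otimes 1\otimes\cdots\otimes 1$ ($a$ acts on the first $j$ factors). For $1\le i<N$ let $e_i=1-s_i\in\mathrm{End}(\mathsf V^{\otimes N})$, where $s_i$ interchanges the $i$-th and $(i+1)$-st tensor factors. For $r,s\in\{-1,1\}^k$ let $E_{r,s}$ be the matrix unit with $E_{r,s}v_t=\delta_{s,t}v_r$, where $v_t=v_{t_1}\otimes\cdots\otimes v_{t_k}$. The relations below hold in $\mathrm{End}(\mathsf V^{\otimes N})$ for every $N\ge k$ such that all $e_i$ in the relation have $i<N$. For $\ell, m\ge 0$ and elements $b_0,\dots,b_m$ with numbers $d_0,\dots,d_m$, consider the relations (a) $e_i^2=2e_i$, $e_ie_{i\pm1}e_i=e_i$,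 and $e_ie_j=e_je_i$ for $|i-j|>1$; (b) $b_ib_j=b_j=b_jb_i$ for $0\le i\le j\le m$; (c) $b_{j+1}=b_j-\frac{d_{j-1}}{d_j}b_je_{\ell+j}b_j$; (d) $e_ib_j=0=b_je_i$ for $0\le j\le m$, $1\le i<\ell+j$, and $e_ib_j=b_je_i$ for $0\le j\le m$, $i>\ell+j$; (e) $e_{\ell+j}b_je_{\ell+j}=\frac{d_j}{d_{j-1}}b_{j-1}e_{\ell+j}$ for $1\le j\le m$. **Cyclic case.** Let $n\ge1$, let $\zeta$ be a primitive $n$-th root of unity, and let $\mathbf C_n$ be the cyclic group generated by $g=\mathrm{diag}(\zeta^{-1},\zeta)$. Put $\tilde n=n/2$ if $n$ is even and $\tilde n=n$ if $n$ is odd, and let $k\ge\tilde n=\mathrm{diam}(\mathbf C_n)$. For $0\le j\le\tilde n$ let $b_j^{\pm}\in\mathsf Z_j(\mathbf C_n)$ be the projection of $\mathsf V^{\otimes j}$ onto the one-dimensional module $\mathbf C_n^{(\pm j)}$ on which $g$ acts by $\zeta^{\pm j}$ (this determines it for $j<\tilde n$; for $j=\tilde n$ the projection meant is $b_{\tilde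 n}^{\pm}=E_{\pm\underline 1,\pm\underline 1}$, with $\underline 1$ the $\tilde n$-tuple of $1$s). Put $b_+^-=E_{-\underline 1,\underline 1}$, $b_-^+=E_{\underline 1,-\underline 1}$, $b_+^+=b_{\tilde n}^+$, $b_-^-=b_{\tilde n}^-$. These projections exist, and $\mathsf Z_k(\mathbf C_n)$ is generated by $e_i$ $(1\le i<k)$, $b_j^\pm$ $(1\le j\le\tilde n)$, $b_+^-$ and $b_-^+$. Relations (a)-(e) hold, with $\ell=0$, $m=\tilde n$, all $d_j=1$, and (c) for $1\le j\le\tilde n-1$, both for $b_j=b_j^+$ and for $b_j=b_j^-$. In addition: ($\mathrm f_{\mathbf C}$) $(b_{\tilde n}^\pm)^2=b_{\tilde n}^\pm$, and $b_i^\pm b_j^\mp=0=b_j^\mp b_i^\pm$ for $1\le i,j\le\tilde n$; ($\mathrm g_{\mathbf C}$) $b_\gamma^\delta b_\eta^\vartheta=\delta_{\gamma,\vartheta}\,b_\eta^\delta$ for all signs $\gamma,\delta,\eta,\vartheta$; and for $1\le j<\tilde n$, every sign $\alpha$ and all signs $\gamma\ne\delta$: $b_j^\alpha b_\gamma^\delta$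 equals $b_\gamma^\delta$ if $\alpha=\delta$ and $0$ otherwise, while $b_\gamma^\delta b_j^\alpha$ equals $b_\gamma^\delta$ if $\alpha=\gamma$ and $0$ otherwise. **Binary dihedral case.** Let $n\ge2$, let $\zeta$ be a primitive $2n$-th root of unity, and let $\mathbf D_n$ be generated by $g=\mathrm{diag}(\zeta^{-1},\zeta)$ and $h=\begin{pmatrix}0&i\\ i&0\end{pmatrix}$. Let $k\ge n=\mathrm{diam}(\mathbf D_n)$. For $1\le p\le n-1$ let $\mathbf D_n^{(p)}$ be the two-dimensional module with basis $v_{-p},v_p$ such that $gv_{\pm p}=\zeta^{\pm p}v_{\pm p}$ and $hv_{\pm p}=i^pv_{\mp p}$; let $\mathbf D_n^{(n)}$ and $\mathbf D_n^{(n')}$ be the one-dimensional modules on which $g$ acts by $-1$ and $h$ acts by $i^n$ and $-i^n$, respectively. For $0\le j<n$ let $b_j\in\mathsf Z_{j+1}(\mathbf D_n)$ be the projection of $\mathsf V^{\otimes(j+1)}$ onto $\mathbf D_n^{(j+1)}$ (so $b_0=1$), and let $b'\in\mathsf Z_n(\mathbf D_n)$ be the projection of $\mathsf V^{\otimes n}$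 onto $\mathbf D_n^{(n')}$. Put $d_j=\dim\mathbf D_n^{(j+1)}$, that is, $d_j=2$ for $j<n-1$ and $d_{n-1}=1$. These projections exist, and $\mathsf Z_k(\mathbf D_n)$ is generated by $e_i$ $(1\le i<k)$, $b_j$ $(1\le j<n)$ and $b'$. Relations (a)-(e) hold with $\ell=1$, $m=n-1$, and (c) for $1\le j\le n-3$, while for $n\ge3$ the last step of the recursion is $b_{n-1}+b'=b_{n-2}-b_{n-2}e_{n-1}b_{n-2}$. In addition: (f) $b_{n-1}=\frac{d_{n-2}}{d_{n-1}}b_{n-1}e_nb_{n-1}$; ($\mathrm g_{\mathbf D}$) $b_jb'=b'=b'b_j$ for $1\le j<n-1$, $(b')^2=b'$, and $b_{n-1}b'=0=b'b_{n-1}$; ($\mathrm h_{\mathbf D}$) $e_nb'e_n=\frac12b_{n-2}e_n$, $e_ib'=0=b'e_i$ for $1\le i<n$, and $e_ib'=b'e_i$ for $i>n$; ($\mathrm i_{\mathbf D}$) $b_{n-1}=2b_{n-1}e_nb_{n-1}$ and $b'=2b'e_nb'$. -/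

import Mathlib

open scoped TensorProduct

namespace McKay

noncomputable section

/-! ### The natural module, its tensor powers, and the centralizer algebras -/

/-- The group `SU₂` of special unitary `2 × 2` complex matrices. -/
abbrev SU2 : Type := Matrix.specialUnitaryGroup (Fin 2) ℂ

/-- The natural module `V = ℂ²` of column vectors.  Coordinate `0` belongs to the basis vector
`v₋₁ = (1,0)ᵗ` and coordinate `1` to `v₁ = (0,1)ᵗ`; thus a sign `-1` or `1` is written as an
element `0` or `1` of `Fin 2`. -/
abbrev V : Type := Fin 2 → ℂ

/-- The tensor power `V^{⊗k}`. -/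
abbrev TPow (k : ℕ) : Type := TensorPower ℂ k V

/-- The integer `-1` or `1` encoded by a sign. -/
def sgn (s : Fin 2) : ℤ := if s = 1 then 1 else -1

/-- The action of `SU₂` on `V^{⊗k}`: `A (x₁ ⊗ ⋯ ⊗ xₖ) = A x₁ ⊗ ⋯ ⊗ A xₖ`. -/
def tensorAction (k : ℕ) (A : SU2) : Module.End ℂ (TPow k) :=
  PiTensorProduct.map fun _ : Fin k => Matrix.toLin' (A : Matrix (Fin 2) (Fin 2) ℂ)

/-- The centralizer algebra `Z_k(G) = End_G(V^{⊗k})`. -/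
def centralizerAlgebra (G : Subgroup SU2) (k : ℕ) : Subalgebra ℂ (Module.End ℂ (TPow k)) :=
  Subalgebra.centralizer ℂ (tensorAction k '' (G : Set SU2))

/-- The operator `e_i` on `V^{⊗N}`, for `1 ≤ i < N`: the identity minus the interchange of the
`i`-th and `(i+1)`-st tensor factors (counted from `1`).  It is only used for `1 ≤ i < N`. -/
def e (N i : ℕ) : Module.End ℂ (TPow N) :=
  if h : 1 ≤ i ∧ i < N then
    1 - (PiTensorProduct.reindex ℂ (fun _ : Fin N => V)
      (Equiv.swap (⟨i - 1, by omega⟩ : Fin N) ⟨i, h.2⟩)).toLinearMap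
  else 0

/-- The embedding `End(V^{⊗j}) → End(V^{⊗N})`, `a ↦ a ⊗ 1 ⊗ ⋯ ⊗ 1`, for `j ≤ N`, where `a` acts
on the first `j` tensor factors.  It is only used for `j ≤ N`. -/
def emb (N : ℕ) {j : ℕ} (a : Module.End ℂ (TPow j)) : Module.End ℂ (TPow N) :=
  if h : j ≤ N then
    ((TensorPower.mulEquiv (R := ℂ) (M := V) (n := j) (m := N - j)).trans
      (TensorPower.cast ℂ V (Nat.add_sub_cancel' h))).conj (a.rTensor (TPow (N - j)))
  else 0

/-- The matrix unit `E_{r,s}` of `End(V^{⊗k})` with respect to the basis of the simple tensors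
`v_t = v_{t₁} ⊗ ⋯ ⊗ v_{tₖ}`: it is the tensor product of the `2 × 2` matrix units
`E_{rᵢ,sᵢ}`, that is, it sends `v_s` to `v_r` and every other `v_t` to `0`. -/
def matUnit {k : ℕ} (r s : Fin k → Fin 2) : Module.End ℂ (TPow k) :=
  PiTensorProduct.map fun i : Fin k =>
    Matrix.toLin' (Matrix.single (r i) (s i) (1 : ℂ))

/-- `f` lies in `Z_k(G)` and is a projection of `V^{⊗k}` onto a submodule of the kind `P`. -/
structure IsProjectionOnto (G : Subgroup SU2) (k : ℕ) (P : Submodule ℂ (TPow k) → Prop)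
    (f : Module.End ℂ (TPow k)) : Prop where
  mem : f ∈ centralizerAlgebra G k
  idem : f * f = f
  range : P (LinearMap.range f)

/-! ### The relations common to both families -/

/-- The relations (a)-(e) in `End(V^{⊗N})`, for elements `b_0, …, b_m` with associated dimensions
`d_0, …, d_m` and branch node `ℓ`; the recursion (c) is asserted for the elements `b_{j+1}` with
`2 ≤ j + 1 ≤ M`. -/
structure BaseRelations (N ℓ m M : ℕ) (d : ℕ → ℂ) (b : ℕ → Module.End ℂ (TPow N)) : Prop where
  a_sq : ∀ i, 1 ≤ i → i < N → e N i * e N i = (2 : ℂ) • e N i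
  a_braid : ∀ i, 1 ≤ i → i + 1 < N →
    e N i * e N (i + 1) * e N i = e N i ∧ e N (i + 1) * e N i * e N (i + 1) = e N (i + 1)
  a_comm : ∀ i j, 1 ≤ i → i + 1 < j → j < N → e N i * e N j = e N j * e N i
  b_abs : ∀ i j, i ≤ j → j ≤ m → b i * b j = b j ∧ b j * b i = b j
  c_rec : ∀ j, 1 ≤ j → j + 1 ≤ M →
    b (j + 1) = b j - (d (j - 1) / d j) • (b j * e N (ℓ + j) * b j)
  d_zero : ∀ i j, j ≤ m → 1 ≤ i → i < ℓ + j → e N i * b j = 0 ∧ b j * e N i = 0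
  d_comm : ∀ i j, j ≤ m → ℓ + j < i → i < N → e N i * b j = b j * e N i
  e_rel : ∀ j, 1 ≤ j → j ≤ m → ℓ + j < N →
    e N (ℓ + j) * b j * e N (ℓ + j) = (d j / d (j - 1)) • (b (j - 1) * e N (ℓ + j))

/-! ### The cyclic groups -/

/-- The element `diag(ζ⁻¹, ζ)` of `SU₂`, for a complex number `ζ` of modulus one. -/
def gMat (ζ : Circle) : SU2 :=
  ⟨!![((ζ⁻¹ : Circle) : ℂ), 0; 0, (ζ : ℂ)], by
    rw [Matrix.mem_specialUnitaryGroup_iff, Matrix.mem_unitaryGroup_iff]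
    refine ⟨?_, ?_⟩
    · ext i j
      fin_cases i <;> fin_cases j <;>
        simp [Matrix.mul_apply, Matrix.star_apply, Complex.mul_conj]
    · simp [Matrix.det_fin_two]⟩

/-- The cyclic group `C_n ⊆ SU₂` generated by `diag(ζ⁻¹, ζ)`, for `ζ` a primitive `n`-th root of
unity. -/
def cyclicGroup (ζ : Circle) : Subgroup SU2 := Subgroup.zpowers (gMat ζ)

/-- `ñ = diam(C_n)`: `n / 2` for even `n`, and `n` for odd `n`. -/
def cycDiam (n : ℕ) : ℕ := if Even n then n / 2 else n

/-- `W` is a submodule isomorphic to the one-dimensional module `C_n^{(p)}`, on which the generator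
`diag(ζ⁻¹, ζ)` acts by `ζ^p`. -/
def IsCyclicSimple (ζ : Circle) (p : ℤ) {k : ℕ} (W : Submodule ℂ (TPow k)) : Prop :=
  ∃ w : TPow k, w ≠ 0 ∧ W = Submodule.span ℂ {w} ∧
    tensorAction k (gMat ζ) w = ((ζ ^ p : Circle) : ℂ) • w

/-- `b j s` is the projection `b_j^±` of `V^{⊗j}` onto `C_n^{(±j)}`, for `0 ≤ j ≤ ñ` and `±` the
sign `s`.  For `j < ñ` the module `C_n^{(±j)}` occurs once in `V^{⊗j}`, so the first field
determines `b j s`.  For `j = ñ` the modules `C_n^{(j)}` and `C_n^{(-j)}` are isomorphic, and the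
projections meant are the diagonal matrix units onto the lines of `v_{±1} ⊗ ⋯ ⊗ v_{±1}`. -/
structure IsCyclicFamily (n : ℕ) (ζ : Circle)
    (b : (j : ℕ) → Fin 2 → Module.End ℂ (TPow j)) : Prop where
  proj : ∀ j s, j ≤ cycDiam n →
    IsProjectionOnto (cyclicGroup ζ) j (IsCyclicSimple ζ (sgn s * j)) (b j s)
  top : ∀ s, b (cycDiam n) s = matUnit (fun _ => s) (fun _ => s)

/-- The element `b_γ^δ` of `End(V^{⊗N})`, for signs `γ` and `δ`: the projection `b_ñ^±` if
`γ = δ = ±`, and the off-diagonal matrix unit `E_{δ1,γ1}` of `End(V^{⊗ñ})` if `γ ≠ δ`, where `1` is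
the constant `ñ`-tuple. -/
def cycUnit (n N : ℕ) (b : (j : ℕ) → Fin 2 → Module.End ℂ (TPow j)) (δ γ : Fin 2) :
    Module.End ℂ (TPow N) :=
  if δ = γ then emb N (b (cycDiam n) δ)
  else emb N (matUnit (k := cycDiam n) (fun _ => δ) (fun _ => γ))

/-- The generators `e_i`, `b_j^±`, `b_+^-`, `b_-^+` of `Z_k(C_n)`. -/
def cyclicGenerators (n k : ℕ) (b : (j : ℕ) → Fin 2 → Module.End ℂ (TPow j)) :
    Set (Module.End ℂ (TPow k)) :=
  {x | ∃ i, 1 ≤ i ∧ i < k ∧ x = e k i} ∪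
  {x | ∃ j s, 1 ≤ j ∧ j ≤ cycDiam n ∧ x = emb k (b j s)} ∪
  {x | ∃ δ γ, δ ≠ γ ∧ x = cycUnit n k b δ γ}

/-- The relations for `C_n` in `End(V^{⊗N})`. -/
structure CyclicRelations (n N : ℕ) (b : (j : ℕ) → Fin 2 → Module.End ℂ (TPow j)) : Prop where
  base : ∀ s, BaseRelations N 0 (cycDiam n) (cycDiam n) (fun _ => 1) (fun j => emb N (b j s))
  f_idem : ∀ s, emb N (b (cycDiam n) s) * emb N (b (cycDiam n) s) = emb N (b (cycDiam n) s)
  f_orth : ∀ i j s t, 1 ≤ i → i ≤ cycDiam n → 1 ≤ j → j ≤ cycDiam n → s ≠ t →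
    emb N (b i s) * emb N (b j t) = 0
  g_units : ∀ γ δ η θ,
    cycUnit n N b δ γ * cycUnit n N b θ η = if γ = θ then cycUnit n N b δ η else 0
  g_left : ∀ j α γ δ, 1 ≤ j → j < cycDiam n → δ ≠ γ →
    emb N (b j α) * cycUnit n N b δ γ = if α = δ then cycUnit n N b δ γ else 0
  g_right : ∀ j α γ δ, 1 ≤ j → j < cycDiam n → δ ≠ γ →
    cycUnit n N b δ γ * emb N (b j α) = if α = γ then cycUnit n N b δ γ else 0

/-! ### The binary dihedral groups -/

/-- The element `h` of `SU₂` with zero diagonal and off-diagonal entries `i`. -/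
def hMat : SU2 :=
  ⟨!![0, Complex.I; Complex.I, 0], by
    rw [Matrix.mem_specialUnitaryGroup_iff, Matrix.mem_unitaryGroup_iff]
    refine ⟨?_, ?_⟩
    · ext i j
      fin_cases i <;> fin_cases j <;>
        simp [Matrix.mul_apply, Matrix.star_apply]
    · simp [Matrix.det_fin_two]⟩

/-- The binary dihedral group `D_n ⊆ SU₂` of order `4n` generated by `diag(ζ⁻¹, ζ)` and `h`, for
`ζ` a primitive `2n`-th root of unity. -/
def dihedralGroup (ζ : Circle) : Subgroup SU2 := Subgroup.closure {gMat ζ, hMat}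

/-- `W` is a submodule isomorphic to the two-dimensional module `D_n^{(p)}`, which has a basis
`v_{-p}, v_p` with `g v_{±p} = ζ^{±p} v_{±p}` and `h v_{±p} = i^p v_{∓p}`. -/
def IsDihedralTwoDim (ζ : Circle) (p : ℕ) {k : ℕ} (W : Submodule ℂ (TPow k)) : Prop :=
  ∃ u w : TPow k, LinearIndependent ℂ ![u, w] ∧ W = Submodule.span ℂ {u, w} ∧
    tensorAction k (gMat ζ) u = ((ζ ^ (-(p : ℤ)) : Circle) : ℂ) • u ∧
    tensorAction k (gMat ζ) w = ((ζ ^ (p : ℤ) : Circle) : ℂ) • w ∧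
    tensorAction k hMat u = Complex.I ^ p • w ∧
    tensorAction k hMat w = Complex.I ^ p • u

/-- `W` is a submodule isomorphic to the one-dimensional module on which `g` acts by `-1` and `h`
by `c`; it is `D_n^{(n)}` for `c = i^n`, and `D_n^{(n')}` for `c = -i^n`. -/
def IsDihedralOneDim (ζ : Circle) (c : ℂ) {k : ℕ} (W : Submodule ℂ (TPow k)) : Prop :=
  ∃ w : TPow k, w ≠ 0 ∧ W = Submodule.span ℂ {w} ∧
    tensorAction k (gMat ζ) w = -w ∧ tensorAction k hMat w = c • w

/-- `b j` is the projection `b_j` of `V^{⊗(j+1)}` onto `D_n^{(j+1)}`, for `0 ≤ j < n`, and `b'` is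
the projection of `V^{⊗n}` onto `D_n^{(n')}`.  Each of these modules occurs once in the tensor
power in question, so the projections are determined. -/
structure IsDihedralFamily (n : ℕ) (ζ : Circle)
    (b : (j : ℕ) → Module.End ℂ (TPow (j + 1))) (b' : Module.End ℂ (TPow n)) : Prop where
  proj : ∀ j, j + 1 < n →
    IsProjectionOnto (dihedralGroup ζ) (j + 1) (IsDihedralTwoDim ζ (j + 1)) (b j)
  top : ∀ j, j + 1 = n →
    IsProjectionOnto (dihedralGroup ζ) (j + 1) (IsDihedralOneDim ζ (Complex.I ^ n)) (b j)
  prime : IsProjectionOnto (dihedralGroup ζ) n (IsDihedralOneDim ζ (-Complex.I ^ n)) b'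

/-- The dimension of `D_n^{(j+1)}` for `0 ≤ j < n`. -/
def dihDim (n j : ℕ) : ℂ := if j + 1 = n then 1 else 2

/-- The generators `e_i`, `b_j`, `b'` of `Z_k(D_n)`. -/
def dihedralGenerators (n k : ℕ) (b : (j : ℕ) → Module.End ℂ (TPow (j + 1)))
    (b' : Module.End ℂ (TPow n)) : Set (Module.End ℂ (TPow k)) :=
  {x | ∃ i, 1 ≤ i ∧ i < k ∧ x = e k i} ∪
  {x | ∃ j, 1 ≤ j ∧ j < n ∧ x = emb k (b j)} ∪ {emb k b'}

/-- The relations for `D_n` in `End(V^{⊗N})`. -/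
structure DihedralRelations (n N : ℕ) (b : (j : ℕ) → Module.End ℂ (TPow (j + 1)))
    (b' : Module.End ℂ (TPow n)) : Prop where
  base : BaseRelations N 1 (n - 1) (n - 2) (dihDim n) (fun j => emb N (b j))
  c_top : 3 ≤ n → emb N (b (n - 1)) + emb N b' =
    emb N (b (n - 2)) - emb N (b (n - 2)) * e N (n - 1) * emb N (b (n - 2))
  f_rel : n < N → emb N (b (n - 1)) =
    (dihDim n (n - 2) / dihDim n (n - 1)) • (emb N (b (n - 1)) * e N n * emb N (b (n - 1)))
  g_abs : ∀ j, 1 ≤ j → j < n - 1 → emb N (b j) * emb N b' = emb N b' ∧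
    emb N b' * emb N (b j) = emb N b'
  g_idem : emb N b' * emb N b' = emb N b'
  g_orth : emb N (b (n - 1)) * emb N b' = 0 ∧ emb N b' * emb N (b (n - 1)) = 0
  h_exp : n < N →
    e N n * emb N b' * e N n = (1 / 2 : ℂ) • (emb N (b (n - 2)) * e N n)
  h_zero : ∀ i, 1 ≤ i → i < n → e N i * emb N b' = 0 ∧ emb N b' * e N i = 0
  h_comm : ∀ i, n < i → i < N → e N i * emb N b' = emb N b' * e N i
  i_top : n < N →
    emb N (b (n - 1)) = (2 : ℂ) • (emb N (b (n - 1)) * e N n * emb N (b (n - 1)))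
  i_prime : n < N → emb N b' = (2 : ℂ) • (emb N b' * e N n * emb N b')

end

end McKay

namespace McKay

noncomputable section


/-! In the basis of simple tensors `vec t` both groups act monomially. With `wt t` the number of
entries `v₁`, the generator `g` multiplies `vec t` by `ζ ^ (2 * wt t - k)`, and `h` sends it to `I ^
k • vec (flip t)`. If `D` is the diameter, then `ζ ^ (2x) = 1` exactly when `D ∣ x` (`HasDiam`).
Hence an operator commutes with `g` iff its matrix entries `(r, s)` vanish unless `wt r ≡ wt s`
modulo `D`; it commutes with `h` iff the entries at `(r, s)` and `(flip r, flip s)` agree.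

This makes the abstract projections explicit. In fewer than `D` factors the constant sequences are
alone in their weight classes modulo `D`, so the projections are diagonal matrix units
(`eq_matUnit_of_cyclic`) or sums of two of them (`eq_twoProj`). In exactly `D` factors the two
constant sequences share a class: in the cyclic case the matrix units are prescribed, and in the
dihedral case `h` separates the lines of `v_{-1}⊗⋯⊗v_{-1} ± v_1⊗⋯⊗v_1` (`eq_oneProj`).

All relations thus concern the operators `prefixUnit N j α β`, which replace a prefix of `j` entries
`β` by entries `α`, and the `e_i`. The decisive products are `prefixUnit_mul_e_mul_prefixUnit_vec`
and `e_mul_prefixUnit_mul_e`; the latter and the braid relation use that there are only two signs.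

For generation, the `e_i` yield all permutations of the factors. The projections on the first
factor, or the first two, then yield the diagonal units `E_{r,r}`, or `E_{r,r} + E_{flip r, flip
r}`. Permutations connect sequences of equal weight, and the off-diagonal units on `D` factors shift
the weight by `D`; by `rel_of_dvd_wt_sub` every unit permitted by the congruence is reached
(`centralizer_cyclic_le`, `centralizer_dihedral_le`). -/

/-! ### The basis of simple tensors -/

/-- The simple tensor `v_t = v_{t₁} ⊗ ⋯ ⊗ v_{tₖ}`. -/
def vec {k : ℕ} (t : Fin k → Fin 2) : TPow k :=
  PiTensorProduct.tprod ℂ fun i => (Pi.single (t i) 1 : V)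

/-- The simple tensors `v_t` form a basis of `V^{⊗k}`. -/
def vecBasis (k : ℕ) : Module.Basis (Fin k → Fin 2) ℂ (TPow k) :=
  Basis.piTensorProduct fun _ => Pi.basisFun ℂ (Fin 2)

@[simp]
theorem vecBasis_apply {k : ℕ} (t : Fin k → Fin 2) : vecBasis k t = vec t := by
  simp [vecBasis, vec]

theorem end_ext {k : ℕ} {a b : Module.End ℂ (TPow k)} (h : ∀ t, a (vec t) = b (vec t)) :
    a = b :=
  (vecBasis k).ext fun t => by simpa using h t

theorem vec_ne_zero {k : ℕ} (t : Fin k → Fin 2) : vec t ≠ 0 := by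
  rw [← vecBasis_apply]
  exact (vecBasis k).ne_zero t

@[simp]
theorem repr_vec {k : ℕ} (t : Fin k → Fin 2) :
    (vecBasis k).repr (vec t) = Finsupp.single t 1 := by
  rw [← vecBasis_apply, Module.Basis.repr_self]

theorem matUnit_vec {k : ℕ} (r s t : Fin k → Fin 2) :
    matUnit r s (vec t) = if t = s then vec r else 0 := by
  simp only [matUnit, vec, PiTensorProduct.map_tprod]
  split_ifs with h
  · subst h
    congr 1
    ext i a
    simp [Matrix.single_apply, Pi.single_apply, eq_comm]
  · obtain ⟨i, hi⟩ := Function.ne_iff.1 h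
    refine MultilinearMap.map_coord_zero _ i ?_
    ext a
    simp [Ne.symm hi]

/-- The permutation of tensor factors. -/
def perm {k : ℕ} (σ : Equiv.Perm (Fin k)) : Module.End ℂ (TPow k) :=
  (PiTensorProduct.reindex ℂ (fun _ : Fin k => V) σ).toLinearMap

theorem perm_vec {k : ℕ} (σ : Equiv.Perm (Fin k)) (t : Fin k → Fin 2) :
    perm σ (vec t) = vec (t ∘ σ.symm) := by
  simp only [perm, vec]
  exact PiTensorProduct.reindex_tprod _ _

theorem perm_one {k : ℕ} : perm (1 : Equiv.Perm (Fin k)) = 1 :=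
  end_ext fun t => by rw [perm_vec]; rfl

theorem perm_mul {k : ℕ} (σ τ : Equiv.Perm (Fin k)) : perm (σ * τ) = perm σ * perm τ :=
  end_ext fun t => by simp only [Module.End.mul_apply, perm_vec]; rfl

theorem e_eq {N i : ℕ} (h1 : 1 ≤ i) (h2 : i < N) :
    e N i = 1 - perm (Equiv.swap (⟨i - 1, by omega⟩ : Fin N) ⟨i, h2⟩) := by
  rw [e, dif_pos ⟨h1, h2⟩]; rfl

/-- The family `t` with its entries in the positions `i` and `i + 1`, counted from `1`,
interchanged. -/
def swp {N : ℕ} (i : ℕ) (h2 : i < N) (t : Fin N → Fin 2) : Fin N → Fin 2 :=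
  t ∘ Equiv.swap (⟨i - 1, by omega⟩ : Fin N) ⟨i, h2⟩

theorem e_vec {N i : ℕ} (h1 : 1 ≤ i) (h2 : i < N) (t : Fin N → Fin 2) :
    e N i (vec t) = vec t - vec (swp i h2 t) := by
  rw [e_eq h1 h2, LinearMap.sub_apply, perm_vec]; rfl

theorem swp_swp {N : ℕ} (i : ℕ) (h2 : i < N) (t : Fin N → Fin 2) : swp i h2 (swp i h2 t) = t := by
  ext x; simp [swp]

theorem swp_apply {N : ℕ} (i : ℕ) (h2 : i < N) (t : Fin N → Fin 2) (x : Fin N) :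
    swp i h2 t x = if x.val = i - 1 then t ⟨i, h2⟩ else
      if x.val = i then t ⟨i - 1, by omega⟩ else t x := by
  simp only [swp, Function.comp, Equiv.swap_apply_def, Fin.ext_iff]
  split_ifs <;> rfl

/-! ### Diagonal action of the generators -/

/-- The sequence of signs opposite to those of `t`. -/
def flip {k : ℕ} (t : Fin k → Fin 2) : Fin k → Fin 2 := fun i => 1 - t i

@[simp]
theorem flip_flip {k : ℕ} (t : Fin k → Fin 2) : flip (flip t) = t := by
  ext i; simp [flip]

theorem flip_const {k : ℕ} (a : Fin 2) : flip (fun _ : Fin k => a) = fun _ => 1 - a := rfl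

theorem hMat_vec {k : ℕ} (t : Fin k → Fin 2) :
    tensorAction k hMat (vec t) = Complex.I ^ k • vec (flip t) := by
  simp only [tensorAction, vec, PiTensorProduct.map_tprod]
  have : (fun i => Matrix.toLin' (hMat : Matrix (Fin 2) (Fin 2) ℂ) (Pi.single (t i) 1 : V)) =
      fun i => Complex.I • (Pi.single (flip t i) 1 : V) := by
    funext i
    have : t i = 0 ∨ t i = 1 := by omega
    rcases this with h | h <;> ext a <;> fin_cases a <;>
      simp [hMat, flip, h, Matrix.toLin'_apply]
  rw [this, MultilinearMap.map_smul_univ]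
  simp

/-- The number of entries `v₁` in the simple tensor `v_t`. -/
def wt {k : ℕ} (t : Fin k → Fin 2) : ℕ := ∑ i, (t i).val

/-- Each factor is an eigenvector for `ζ ^ (2a - 1)` with `a ∈ {0, 1}`, and the exponents add up.
The `g`-eigenspaces are therefore cut out by the weight alone. -/
theorem gMat_vec (ζ : Circle) {k : ℕ} (t : Fin k → Fin 2) :
    tensorAction k (gMat ζ) (vec t) = ((ζ ^ (2 * (wt t : ℤ) - k) : Circle) : ℂ) • vec t := by
  simp only [tensorAction, vec, PiTensorProduct.map_tprod]
  have : (fun i => Matrix.toLin' (gMat ζ : Matrix (Fin 2) (Fin 2) ℂ) (Pi.single (t i) 1 : V)) =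
      fun i => ((ζ ^ (2 * ((t i).val : ℤ) - 1) : Circle) : ℂ) • (Pi.single (t i) 1 : V) := by
    funext i
    have : t i = 0 ∨ t i = 1 := by omega
    rcases this with h | h <;> ext a <;> fin_cases a <;>
      simp [gMat, h, Matrix.toLin'_apply]
  rw [this, MultilinearMap.map_smul_univ]
  congr 1
  have hζ : (ζ : ℂ) ≠ 0 := Circle.coe_ne_zero ζ
  have h (m : ℕ) : (ζ : ℂ) ^ (2 * (m : ℤ) - 1) = ((ζ : ℂ) ^ 2) ^ m * (ζ : ℂ)⁻¹ := by
    rw [zpow_sub₀ hζ, zpow_mul]; norm_cast; rw [pow_one, div_eq_mul_inv]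
  simp only [Circle.coe_zpow, h, Finset.prod_mul_distrib, Finset.prod_pow_eq_pow_sum,
    Finset.prod_const, Finset.card_univ, Fintype.card_fin, zpow_sub₀ hζ, zpow_mul]
  norm_cast
  simp [wt, div_eq_mul_inv]

/-! ### The embedding of endomorphism algebras -/

theorem emb_add {N j : ℕ} (a b : Module.End ℂ (TPow j)) : emb N (a + b) = emb N a + emb N b := by
  rw [emb, emb, emb]
  split_ifs
  · rw [LinearMap.rTensor_add, map_add]
  · simp

theorem emb_smul {N j : ℕ} (c : ℂ) (a : Module.End ℂ (TPow j)) : emb N (c • a) = c • emb N a := by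
  rw [emb, emb]
  split_ifs
  · rw [LinearMap.rTensor_smul, map_smul]
  · simp

/-- The sequence `t` with its first `j` entries replaced by those of `r`. -/
def put {N j : ℕ} (r : Fin j → Fin 2) (t : Fin N → Fin 2) : Fin N → Fin 2 :=
  fun i => if h : i.val < j then r ⟨i, h⟩ else t i

theorem emb_matUnit_vec {N j : ℕ} (h : j ≤ N) (r s : Fin j → Fin 2) (t : Fin N → Fin 2) :
    emb N (matUnit r s) (vec t) =
      if (fun i : Fin j => t (Fin.castLE h i)) = s then vec (put r t) else 0 := by
  -- Gluing a head `q` to the tail of `t` gives `put q t`. This is used once with the head of `t`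
  -- itself, to split `vec t`, and once with `r`, to reassemble the image.
  have key (q : Fin j → Fin 2) : ((TensorPower.mulEquiv (R := ℂ) (M := V) (n := j)
      (m := N - j)).trans (TensorPower.cast ℂ V (Nat.add_sub_cancel' h)))
        (vec q ⊗ₜ vec fun i => t ⟨j + i, by omega⟩) = vec (put q t) := by
    rw [LinearEquiv.trans_apply, ← TensorPower.gMul_def, vec, vec, TensorPower.tprod_mul_tprod,
      TensorPower.cast_tprod, vec]
    congr 1
    funext i
    simp only [Function.comp, put]
    split_ifs with hi
    · rw [show Fin.cast (Nat.add_sub_cancel' h).symm i = Fin.castAdd _ ⟨i, hi⟩ from rfl,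
        Fin.append_left]
    · rw [show Fin.cast (Nat.add_sub_cancel' h).symm i = Fin.natAdd _ ⟨i - j, by omega⟩ from
        Fin.ext (by simp; omega), Fin.append_right]
      congr 2
      ext
      simp; omega
  have hput : put (fun i : Fin j => t (Fin.castLE h i)) t = t := by
    funext i; simp [put]
  rw [emb, dif_pos h, LinearEquiv.conj_apply]
  conv_lhs => rw [← hput, ← key]
  simp only [LinearMap.comp_apply, LinearEquiv.coe_coe, LinearEquiv.symm_apply_apply,
    LinearMap.rTensor_tmul, matUnit_vec]
  split_ifs
  · exact key r
  · simp


section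


/-! ### Matrix units of constant sequences on the first tensor factors -/

/-- The first `j` entries of `t` equal `β`. -/
def Pre {N : ℕ} (j : ℕ) (β : Fin 2) (t : Fin N → Fin 2) : Prop := ∀ i : Fin N, i.val < j → t i = β

instance {N : ℕ} (j : ℕ) (β : Fin 2) (t : Fin N → Fin 2) : Decidable (Pre j β t) := by
  unfold Pre; infer_instance

/-- The sequence `t` with its first `j` entries replaced by `α`. -/
def rep {N : ℕ} (j : ℕ) (α : Fin 2) (t : Fin N → Fin 2) : Fin N → Fin 2 :=
  fun i => if i.val < j then α else t i

/-- The matrix unit `E_{α⋯α,β⋯β}` of `End(V^{⊗j})`, acting on the first `j` factors. -/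
def prefixUnit (N j : ℕ) (α β : Fin 2) : Module.End ℂ (TPow N) :=
  emb N (matUnit (k := j) (fun _ => α) fun _ => β)

theorem prefixUnit_vec {N j : ℕ} (h : j ≤ N) (α β : Fin 2) (t : Fin N → Fin 2) :
    prefixUnit N j α β (vec t) = if Pre j β t then vec (rep j α t) else 0 := by
  rw [prefixUnit, emb_matUnit_vec h]
  refine if_congr ⟨fun H i hi => congrFun H ⟨i, hi⟩, fun H => funext fun i => H _ i.2⟩ ?_ rfl
  congr 1

theorem prefixUnit_zero (N : ℕ) (α β : Fin 2) : prefixUnit N 0 α β = 1 :=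
  end_ext fun t => by
    rw [prefixUnit_vec (Nat.zero_le _), if_pos (by simp [Pre])]
    rfl

variable {N : ℕ}

theorem pre_rep {i j : ℕ} (hi : 1 ≤ i) (hij : i ≤ j) (hN : j ≤ N) (α β : Fin 2)
    (t : Fin N → Fin 2) : Pre i β (rep j α t) ↔ α = β := by
  constructor
  · intro H
    simpa [rep, show 0 < j by omega] using H ⟨0, by omega⟩ (show 0 < i by omega)
  · rintro rfl x hx
    simp [rep, show x.val < j by omega]

theorem Pre.mono {i j : ℕ} (hij : i ≤ j) {β : Fin 2} {t : Fin N → Fin 2} (h : Pre j β t) :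
    Pre i β t := fun x hx => h x (by omega)

theorem Pre.eq {j : ℕ} (hj : 1 ≤ j) (hN : j ≤ N) {α β : Fin 2} {t : Fin N → Fin 2}
    (h : Pre j α t) (h' : Pre j β t) : α = β :=
  (h ⟨0, by omega⟩ hj).symm.trans (h' ⟨0, by omega⟩ hj)

theorem rep_rep {i j : ℕ} (hij : i ≤ j) (α β : Fin 2) (t : Fin N → Fin 2) :
    rep j α (rep i β t) = rep j α t := by
  ext x
  simp only [rep]
  split_ifs <;> first | rfl | omega

theorem rep_of_pre {j : ℕ} {α : Fin 2} {t : Fin N → Fin 2} (h : Pre j α t) : rep j α t = t := by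
  ext x
  simp only [rep]
  split_ifs with hx
  · rw [h x hx]
  · rfl

theorem rep_succ {j : ℕ} (h : j < N) (α : Fin 2) (t : Fin N → Fin 2) (ht : t ⟨j, h⟩ = α) :
    rep (j + 1) α t = rep j α t := by
  ext x
  simp only [rep]
  split_ifs with h1 h2
  · rfl
  · rw [← ht, show x = ⟨j, h⟩ from Fin.ext (show x.val = j by omega)]
  · omega
  · rfl

theorem pre_succ {j : ℕ} (h : j < N) (α : Fin 2) (t : Fin N → Fin 2) :
    Pre (j + 1) α t ↔ Pre j α t ∧ t ⟨j, h⟩ = α := by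
  refine ⟨fun H => ⟨H.mono (by omega), H _ (by simp)⟩, fun H x hx => ?_⟩
  by_cases hx' : x.val < j
  · exact H.1 x hx'
  · rw [← H.2, show x = ⟨j, h⟩ from Fin.ext (show x.val = j by omega)]

/-- The right factor leaves at least `i` leading entries `β`, so the prefix test of the left factor
only compares `α` with `β`. For `i = 0` that test would be empty, whence `1 ≤ i`. -/
theorem prefixUnit_mul_of_le_left {i j : ℕ} (hi : 1 ≤ i) (hij : i ≤ j) (hN : j ≤ N)
    (α β γ : Fin 2) :
    prefixUnit N i α α * prefixUnit N j β γ = if α = β then prefixUnit N j β γ else 0 := by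
  refine end_ext fun t => ?_
  rw [Module.End.mul_apply, prefixUnit_vec hN]
  by_cases ht : Pre j γ t
  · rw [if_pos ht, prefixUnit_vec (hij.trans hN)]
    by_cases h : α = β
    · subst h
      have := (pre_rep hi hij hN α α t).2 rfl
      rw [if_pos this, if_pos rfl, prefixUnit_vec hN, if_pos ht, rep_of_pre this]
    · rw [if_neg h, if_neg fun H => h ((pre_rep hi hij hN _ _ t).1 H).symm]; rfl
  · split_ifs
    · rw [prefixUnit_vec hN, if_neg ht, map_zero]
    · simp

theorem prefixUnit_mul_of_le_right {i j : ℕ} (hi : 1 ≤ i) (hij : i ≤ j) (hN : j ≤ N)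
    (α β γ : Fin 2) :
    prefixUnit N j β γ * prefixUnit N i α α = if α = γ then prefixUnit N j β γ else 0 := by
  refine end_ext fun t => ?_
  rw [Module.End.mul_apply, prefixUnit_vec (hij.trans hN)]
  by_cases ht : Pre i α t
  · rw [if_pos ht, rep_of_pre ht]
    by_cases h : α = γ
    · rw [if_pos h]
    · rw [if_neg h, prefixUnit_vec hN, if_neg fun H => h (ht.eq hi (hij.trans hN) (H.mono hij))]
      rfl
  · rw [if_neg ht, map_zero]
    split_ifs with h
    · subst h
      rw [prefixUnit_vec hN, if_neg fun H => ht (H.mono hij)]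
    · simp

theorem prefixUnit_mul {j : ℕ} (hj : 1 ≤ j) (hN : j ≤ N) (α β γ δ : Fin 2) :
    prefixUnit N j α β * prefixUnit N j γ δ = if β = γ then prefixUnit N j α δ else 0 := by
  refine end_ext fun t => ?_
  rw [Module.End.mul_apply, prefixUnit_vec hN]
  by_cases ht : Pre j δ t
  · rw [if_pos ht, prefixUnit_vec hN]
    by_cases h : β = γ
    · subst h
      rw [if_pos rfl, if_pos ((pre_rep hj le_rfl hN _ _ t).2 rfl), prefixUnit_vec hN, if_pos ht,
        rep_rep le_rfl]
    · rw [if_neg h, if_neg fun H => h ((pre_rep hj le_rfl hN _ _ t).1 H).symm]; rfl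
  · split_ifs
    · rw [prefixUnit_vec hN, if_neg ht, map_zero]
    · simp

/-! ### The operators `e_i` and matrix units -/

theorem swp_eq_of_eq {i : ℕ} (h2 : i < N) (t : Fin N → Fin 2)
    (h : t ⟨i - 1, by omega⟩ = t ⟨i, h2⟩) : swp i h2 t = t := by
  ext x
  rw [swp_apply]
  split_ifs with h3 h4
  · rw [← h]; congr 2; ext; exact h3.symm
  · rw [h]; congr 2; ext; exact h4.symm
  · rfl

theorem pre_swp_of_lt {i j : ℕ} (hij : i < j) (h2 : i < N) (β : Fin 2) (t : Fin N → Fin 2) :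
    Pre j β (swp i h2 t) ↔ Pre j β t := by
  have key (t : Fin N → Fin 2) (H : Pre j β t) : Pre j β (swp i h2 t) := by
    intro x hx
    rw [swp_apply]
    split_ifs
    · exact H _ hij
    · exact H _ (by simp; omega)
    · exact H _ hx
  exact ⟨fun H => by simpa [swp_swp] using key _ H, key t⟩

theorem pre_swp_of_gt {i j : ℕ} (hij : j < i) (h2 : i < N) (β : Fin 2) (t : Fin N → Fin 2) :
    Pre j β (swp i h2 t) ↔ Pre j β t := by
  refine forall₂_congr fun x hx => ?_
  rw [swp_apply, if_neg (by omega), if_neg (by omega)]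

theorem rep_swp_of_lt {i j : ℕ} (hij : i < j) (h2 : i < N) (α : Fin 2) (t : Fin N → Fin 2) :
    rep j α (swp i h2 t) = rep j α t := by
  ext x
  simp only [rep]
  split_ifs
  · rfl
  · rw [swp_apply, if_neg (by omega), if_neg (by omega)]

theorem swp_rep_of_lt {i j : ℕ} (hij : i < j) (h2 : i < N) (α : Fin 2) (t : Fin N → Fin 2) :
    swp i h2 (rep j α t) = rep j α t :=
  swp_eq_of_eq _ _ (by simp [rep, hij, show i - 1 < j by omega])

theorem rep_swp_of_gt {i j : ℕ} (hij : j < i) (h2 : i < N) (α : Fin 2) (t : Fin N → Fin 2) :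
    rep j α (swp i h2 t) = swp i h2 (rep j α t) := by
  ext x
  simp only [rep, swp_apply]
  split_ifs <;> first | rfl | omega

theorem e_mul_prefixUnit_of_lt {i j : ℕ} (hi : 1 ≤ i) (hij : i < j) (hN : j ≤ N) (α β : Fin 2) :
    e N i * prefixUnit N j α β = 0 := by
  refine end_ext fun t => ?_
  rw [Module.End.mul_apply, prefixUnit_vec hN]
  split_ifs
  · rw [e_vec hi (by omega), swp_rep_of_lt hij, sub_self]; rfl
  · rw [map_zero]; rfl

theorem prefixUnit_mul_e_of_lt {i j : ℕ} (hi : 1 ≤ i) (hij : i < j) (hN : j ≤ N) (α β : Fin 2) :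
    prefixUnit N j α β * e N i = 0 := by
  refine end_ext fun t => ?_
  rw [Module.End.mul_apply, e_vec hi (by omega), map_sub, prefixUnit_vec hN, prefixUnit_vec hN]
  simp only [pre_swp_of_lt hij, rep_swp_of_lt hij, sub_self]
  rfl

theorem e_comm_prefixUnit {i j : ℕ} (hij : j < i) (hN : i < N) (α β : Fin 2) :
    e N i * prefixUnit N j α β = prefixUnit N j α β * e N i := by
  refine end_ext fun t => ?_
  rw [Module.End.mul_apply, Module.End.mul_apply, e_vec (by omega) hN, map_sub,
    prefixUnit_vec (by omega), prefixUnit_vec (by omega)]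
  simp only [pre_swp_of_gt hij, rep_swp_of_gt hij]
  split_ifs
  · rw [e_vec (by omega) hN]
  · simp

theorem pre_last {j : ℕ} (hj : 1 ≤ j) (hN : j ≤ N) (α : Fin 2) (t : Fin N → Fin 2) :
    Pre j α t ↔ Pre (j - 1) α t ∧ t ⟨j - 1, by omega⟩ = α := by
  obtain ⟨j, rfl⟩ : ∃ i, j = i + 1 := ⟨j - 1, by omega⟩
  exact pre_succ (by omega) α t

theorem rep_last {j : ℕ} (hj : 1 ≤ j) (hN : j ≤ N) (α : Fin 2) (t : Fin N → Fin 2)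
    (ht : t ⟨j - 1, by omega⟩ = α) : rep j α t = rep (j - 1) α t := by
  obtain ⟨j, rfl⟩ : ∃ i, j = i + 1 := ⟨j - 1, by omega⟩
  exact rep_succ (by omega) α t ht

theorem e_vec_swp {i : ℕ} (h1 : 1 ≤ i) (h2 : i < N) (t : Fin N → Fin 2) :
    e N i (vec (swp i h2 t)) = - e N i (vec t) := by
  rw [e_vec h1 h2, e_vec h1 h2, swp_swp, neg_sub]

theorem e_vec_of_eq {i : ℕ} (h1 : 1 ≤ i) (h2 : i < N) (t : Fin N → Fin 2)
    (h : t ⟨i - 1, by omega⟩ = t ⟨i, h2⟩) : e N i (vec t) = 0 := by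
  rw [e_vec h1 h2, swp_eq_of_eq h2 t h, sub_self]

/-- `e_j` kills `v_t` when the entries `j` and `j + 1` agree, and interchanging them changes the
sign. So entry `j` may be taken to be `β` and entry `j + 1` its opposite, and then the interchanged
term fails the prefix test. If `α ≠ β`, the new prefix ends in the sign of entry `j + 1`, and the
outer `e_j` gives zero. -/
theorem e_mul_prefixUnit_mul_e {j : ℕ} (hj : 1 ≤ j) (hN : j < N) (α β : Fin 2) :
    e N j * prefixUnit N j α β * e N j =
      if α = β then prefixUnit N (j - 1) α α * e N j else 0 := by
  refine end_ext fun t => ?_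
  have hjj : j - 1 < j := by omega
  by_cases htt : t ⟨j - 1, by omega⟩ = t ⟨j, hN⟩
  · have := e_vec_of_eq hj hN t htt
    split_ifs <;> simp [Module.End.mul_apply, this]
  have hs1 : swp j hN t ⟨j - 1, by omega⟩ = t ⟨j, hN⟩ := by simp [swp_apply]
  have hs2 : swp j hN t ⟨j, hN⟩ = t ⟨j - 1, by omega⟩ := by
    rw [swp_apply]; simp [show j ≠ j - 1 by omega]
  have main (t : Fin N → Fin 2) (h1 : t ⟨j - 1, by omega⟩ = β) (h2 : t ⟨j, hN⟩ ≠ β) :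
      (e N j * prefixUnit N j α β * e N j) (vec t) =
        (if α = β then prefixUnit N (j - 1) α α * e N j else 0) (vec t) := by
    have hs1 : swp j hN t ⟨j - 1, by omega⟩ = t ⟨j, hN⟩ := by simp [swp_apply]
    rw [Module.End.mul_apply, Module.End.mul_apply, e_vec hj hN t, map_sub,
      prefixUnit_vec hN.le, prefixUnit_vec hN.le, if_neg (c := Pre j β (swp j hN t)), sub_zero]
    · by_cases h : α = β
      · subst h
        rw [if_pos rfl, Module.End.mul_apply, e_vec hj hN t, map_sub, prefixUnit_vec (by omega),
          prefixUnit_vec (by omega)]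
        simp only [pre_swp_of_gt hjj, rep_swp_of_gt hjj]
        rw [rep_last hj hN.le _ _ h1]
        simp only [pre_last hj hN.le, h1, and_true]
        split_ifs
        · rw [e_vec hj hN]
        · simp
      · rw [if_neg h]
        split_ifs with hp
        · rw [e_vec_of_eq hj hN]
          · rfl
          · simp only [rep, hjj, lt_irrefl, if_true, if_false]
            omega
        · rw [map_zero]; rfl
    · intro H
      rw [pre_last hj hN.le, hs1] at H
      exact h2 H.2
  by_cases h : t ⟨j - 1, by omega⟩ = β
  · exact main t h fun h' => htt (h.trans h'.symm)
  · have h' : t ⟨j, hN⟩ = β := by omega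
    have := main (swp j hN t) (hs1.trans h') (by rw [hs2]; exact h)
    -- Both sides of the claim are zero or end in `e_j`, so the case already treated transfers along
    -- the sign change.
    have key (a : Module.End ℂ (TPow N)) (t : Fin N → Fin 2) :
        (a * e N j) (vec (swp j hN t)) = - (a * e N j) (vec t) := by
      rw [Module.End.mul_apply, e_vec_swp hj, map_neg]; rfl
    split_ifs at this ⊢
    · rw [key, key] at this
      exact neg_injective this
    · rw [key] at this
      simpa using this

/-- After the first unit the prefix is constantly `β`. If entry `j + 1` is `β` too, `e_j` gives
zero; otherwise the interchange spoils the prefix, and only the identity part of `e_j = 1 - s_j`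
survives. -/
theorem prefixUnit_mul_e_mul_prefixUnit_vec {j : ℕ} (hj : 1 ≤ j) (hN : j < N) (α β δ : Fin 2)
    (t : Fin N → Fin 2) :
    (prefixUnit N j α β * e N j * prefixUnit N j β δ) (vec t) =
      if Pre j δ t ∧ t ⟨j, hN⟩ ≠ β then vec (rep j α t) else 0 := by
  have hjj : j - 1 < j := by omega
  rw [Module.End.mul_apply, Module.End.mul_apply, prefixUnit_vec hN.le]
  by_cases hp : Pre j δ t
  · have h0 : Pre j β (rep j β t) := (pre_rep hj le_rfl hN.le _ _ t).2 rfl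
    rw [if_pos hp, e_vec hj hN, map_sub, prefixUnit_vec hN.le, prefixUnit_vec hN.le, if_pos h0,
      rep_rep le_rfl]
    have h1 : Pre j β (swp j hN (rep j β t)) ↔ t ⟨j, hN⟩ = β := by
      rw [pre_last hj hN.le, pre_swp_of_gt hjj, swp_apply, if_pos rfl]
      simp only [rep, lt_irrefl, if_false, and_iff_right_iff_imp]
      exact fun _ => h0.mono hjj.le
    by_cases h : t ⟨j, hN⟩ = β
    · have : swp j hN (rep j β t) = rep j β t := swp_eq_of_eq _ _ (by simp [rep, hjj, h])
      rw [if_pos (h1.2 h), this, rep_rep le_rfl, sub_self, if_neg (by simp [h])]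
    · rw [if_neg (mt h1.1 h), sub_zero, if_pos ⟨hp, h⟩]
  · rw [if_neg hp, map_zero, map_zero, if_neg fun H => hp H.1]

/-- The interchange in `e_j` leaves the first `j - 1 ≥ 1` entries equal to `γ`, so neither term
passes the test for `β`. For `j = 1` nothing would protect the prefix. -/
theorem prefixUnit_mul_e_mul_prefixUnit_of_ne {j : ℕ} (hj : 2 ≤ j) (hN : j < N)
    {α β γ δ : Fin 2} (h : β ≠ γ) :
    prefixUnit N j α β * e N j * prefixUnit N j γ δ = 0 := by
  refine end_ext fun t => ?_
  rw [Module.End.mul_apply, Module.End.mul_apply, prefixUnit_vec hN.le]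
  split_ifs
  · rw [e_vec (by omega) hN, map_sub, prefixUnit_vec hN.le, prefixUnit_vec hN.le, if_neg, if_neg,
      sub_zero]
    · rfl
    · intro H
      have := (pre_swp_of_gt (show j - 1 < j by omega) hN β _).1 (H.mono (Nat.sub_le j 1))
      exact h ((pre_rep (by omega) (Nat.sub_le j 1) hN.le _ _ t).1 this).symm
    · exact fun H => h ((pre_rep (by omega) le_rfl hN.le _ _ t).1 H).symm
  · simp

/-- Among sequences with prefix `α` of length `j`, those with a different next entry are the
complement of those with prefix of length `j + 1`. This is the recursion (c). -/
theorem prefixUnit_mul_e_mul_self {j : ℕ} (hj : 1 ≤ j) (hN : j < N) (α : Fin 2) :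
    prefixUnit N j α α * e N j * prefixUnit N j α α =
      prefixUnit N j α α - prefixUnit N (j + 1) α α := by
  refine end_ext fun t => ?_
  rw [prefixUnit_mul_e_mul_prefixUnit_vec hj hN, LinearMap.sub_apply, prefixUnit_vec hN.le,
    prefixUnit_vec hN]
  simp only [pre_succ hN]
  by_cases h1 : Pre j α t <;> by_cases h2 : t ⟨j, hN⟩ = α <;> simp only [h1, h2, rep_succ hN α t, ne_eq, not_true_eq_false,
    not_false_eq_true, and_true, and_false, if_true, if_false, sub_self, sub_zero]

/-- Entry `j + 1` differs from exactly one of the two signs, so exactly one summand acts. -/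
theorem prefixUnit_mul_e_mul_sum {j : ℕ} (hj : 1 ≤ j) (hN : j < N) (α δ : Fin 2) :
    prefixUnit N j α 0 * e N j * prefixUnit N j 0 δ +
      prefixUnit N j α 1 * e N j * prefixUnit N j 1 δ = prefixUnit N j α δ := by
  refine end_ext fun t => ?_
  rw [LinearMap.add_apply, prefixUnit_mul_e_mul_prefixUnit_vec hj hN,
    prefixUnit_mul_e_mul_prefixUnit_vec hj hN, prefixUnit_vec hN.le]
  have : t ⟨j, hN⟩ = 0 ∨ t ⟨j, hN⟩ = 1 := by omega
  rcases this with h | h <;> simp [h]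

/-! ### The Temperley-Lieb relations -/

theorem end_mul_sub {k : ℕ} (a b c : Module.End ℂ (TPow k)) : a * (b - c) = a * b - a * c :=
  LinearMap.ext fun x => by simp

theorem end_sub_mul {k : ℕ} (a b c : Module.End ℂ (TPow k)) : (a - b) * c = a * c - b * c :=
  LinearMap.ext fun x => by simp

theorem e_sq {i : ℕ} (h1 : 1 ≤ i) (h2 : i < N) : e N i * e N i = (2 : ℂ) • e N i := by
  refine end_ext fun t => ?_
  rw [Module.End.mul_apply, e_vec h1 h2, map_sub, e_vec_swp h1 h2, sub_neg_eq_add, ← two_smul ℂ]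
  rw [LinearMap.smul_apply, e_vec h1 h2]

theorem e_comm {i j : ℕ} (h1 : 1 ≤ i) (hij : i + 1 < j) (hN : j < N) :
    e N i * e N j = e N j * e N i := by
  rw [e_eq h1 (by omega), e_eq (by omega) hN]
  have : Equiv.Perm.Disjoint (Equiv.swap (⟨i - 1, by omega⟩ : Fin N) ⟨i, by omega⟩)
      (Equiv.swap (⟨j - 1, by omega⟩ : Fin N) ⟨j, hN⟩) := by
    rw [Equiv.Perm.disjoint_iff_disjoint_support,
      Equiv.Perm.support_swap (by simp [Fin.ext_iff]; omega),
      Equiv.Perm.support_swap (by simp [Fin.ext_iff]; omega)]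
    simp [Fin.ext_iff]; omega
  have h := congrArg perm this.commute.eq
  rw [perm_mul, perm_mul] at h
  simp only [end_mul_sub, end_sub_mul, h, one_mul, mul_one]
  abel

/-- This rests on `dim V = 2`. Both sides vanish on `v_t` if `t a = t b` and change sign under
interchange of `a` and `b`; otherwise `t c` equals `t a` or `t b`, and by antisymmetry one may
assume `t c = t b`. -/
theorem braid_aux {a b c : Fin N} (hac : a ≠ c) (hbc : b ≠ c) :
    (1 - perm (Equiv.swap a b)) * (1 - perm (Equiv.swap b c)) * (1 - perm (Equiv.swap a b)) =
      1 - perm (Equiv.swap a b) := by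
  have hE (x y : Fin N) (t : Fin N → Fin 2) :
      (1 - perm (Equiv.swap x y)) (vec t) = vec t - vec (t ∘ Equiv.swap x y) := by
    rw [LinearMap.sub_apply, perm_vec]; rfl
  have hneg (t : Fin N → Fin 2) : (1 - perm (Equiv.swap a b)) (vec (t ∘ Equiv.swap a b)) =
      - (1 - perm (Equiv.swap a b)) (vec t) := by
    have : (t ∘ Equiv.swap a b) ∘ Equiv.swap a b = t := by ext; simp
    rw [hE, hE, this, neg_sub]
  have hz (x y : Fin N) (t : Fin N → Fin 2) (h : t x = t y) :
      (1 - perm (Equiv.swap x y)) (vec t) = 0 := by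
    have : t ∘ Equiv.swap x y = t := by
      ext z
      simp only [Function.comp, Equiv.swap_apply_def]
      split_ifs with h1 h2
      · rw [h1, h]
      · rw [h2, h]
      · rfl
    rw [hE, this, sub_self]
  have main (t : Fin N → Fin 2) (h : t c = t b) :
      ((1 - perm (Equiv.swap a b)) * (1 - perm (Equiv.swap b c)) * (1 - perm (Equiv.swap a b)))
        (vec t) = (1 - perm (Equiv.swap a b)) (vec t) := by
    rw [Module.End.mul_apply, hE a b t, Module.End.mul_apply, map_sub, hz b c t h.symm,
      hE b c, zero_sub, map_neg, map_sub, hneg, hz a b ((t ∘ Equiv.swap a b) ∘ Equiv.swap b c),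
      sub_zero, neg_neg, hE]
    by_cases hab : a = b
    · rw [hab]
    · simp [Equiv.swap_apply_of_ne_of_ne hab hac,
        Equiv.swap_apply_of_ne_of_ne hac.symm hbc.symm, h]
  refine end_ext fun t => ?_
  by_cases h1 : t a = t b
  · rw [Module.End.mul_apply, hz a b t h1, map_zero]
  by_cases h2 : t c = t b
  · exact main t h2
  · have := main (t ∘ Equiv.swap a b) (by
      simp only [Function.comp, Equiv.swap_apply_of_ne_of_ne hac.symm hbc.symm,
        Equiv.swap_apply_right]
      omega)
    rw [Module.End.mul_apply, hneg, map_neg] at this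
    rw [Module.End.mul_apply]
    exact neg_injective this

theorem e_mul_e_mul_e {i : ℕ} (h1 : 1 ≤ i) (hN : i + 1 < N) :
    e N i * e N (i + 1) * e N i = e N i ∧ e N (i + 1) * e N i * e N (i + 1) = e N (i + 1) := by
  rw [e_eq h1 (by omega), e_eq (by omega) hN]
  have hn (x y : ℕ) (hx : x < N) (hy : y < N) (h : x ≠ y) : (⟨x, hx⟩ : Fin N) ≠ ⟨y, hy⟩ :=
    fun H => h (congrArg Fin.val H)
  refine ⟨braid_aux (hn _ _ _ _ (by omega)) (hn _ _ _ _ (by omega)), ?_⟩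
  have := braid_aux (a := (⟨i + 1, hN⟩ : Fin N)) (b := ⟨i, by omega⟩) (c := ⟨i - 1, by omega⟩)
    (hn _ _ _ _ (by omega)) (hn _ _ _ _ (by omega))
  rw [Equiv.swap_comm (⟨i + 1, hN⟩ : Fin N), Equiv.swap_comm _ (⟨i - 1, by omega⟩ : Fin N)] at this
  exact this

end


/-! ### Coordinates and weights -/

theorem repr_ext {k : ℕ} {x y : TPow k}
    (h : ∀ t, (vecBasis k).repr x t = (vecBasis k).repr y t) : x = y :=
  (vecBasis k).repr.injective (Finsupp.ext h)

theorem repr_gMat (ζ : Circle) {k : ℕ} (x : TPow k) (t : Fin k → Fin 2) :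
    (vecBasis k).repr (tensorAction k (gMat ζ) x) t =
      ((ζ ^ (2 * (wt t : ℤ) - k) : Circle) : ℂ) * (vecBasis k).repr x t := by
  have : (vecBasis k).coord t ∘ₗ tensorAction k (gMat ζ) =
      ((ζ ^ (2 * (wt t : ℤ) - k) : Circle) : ℂ) • (vecBasis k).coord t := by
    refine (vecBasis k).ext fun s => ?_
    simp only [LinearMap.comp_apply, vecBasis_apply, gMat_vec, map_smul, LinearMap.smul_apply,
      Module.Basis.coord_apply, repr_vec, Finsupp.single_apply]
    split_ifs with h
    · rw [h]
    · simp
  exact LinearMap.congr_fun this x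

theorem repr_hMat {k : ℕ} (x : TPow k) (t : Fin k → Fin 2) :
    (vecBasis k).repr (tensorAction k hMat x) t =
      Complex.I ^ k * (vecBasis k).repr x (flip t) := by
  have : (vecBasis k).coord t ∘ₗ tensorAction k hMat =
      Complex.I ^ k • (vecBasis k).coord (flip t) := by
    refine (vecBasis k).ext fun s => ?_
    have : flip s = t ↔ s = flip t :=
      ⟨fun h => by rw [← h, flip_flip], fun h => by rw [h, flip_flip]⟩
    simp only [LinearMap.comp_apply, vecBasis_apply, hMat_vec, map_smul, LinearMap.smul_apply,
      Module.Basis.coord_apply, repr_vec, Finsupp.single_apply, this]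
  exact LinearMap.congr_fun this x

theorem wt_le {k : ℕ} (t : Fin k → Fin 2) : wt t ≤ k := by
  have := Finset.sum_le_sum fun i (_ : i ∈ Finset.univ) => Nat.le_of_lt_succ (t i).isLt
  simpa [wt] using this

theorem wt_const {k : ℕ} (a : Fin 2) : wt (fun _ : Fin k => a) = k * a.val := by
  simp [wt]

theorem eq_const_zero {k : ℕ} {t : Fin k → Fin 2} (h : wt t = 0) : t = fun _ => 0 := by
  funext i
  have := (Finset.sum_eq_zero_iff (s := Finset.univ) (f := fun i => (t i).val)).1 h i
    (Finset.mem_univ i)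
  exact Fin.ext this

theorem wt_flip {k : ℕ} (t : Fin k → Fin 2) : wt (flip t) + wt t = k := by
  rw [wt, wt, ← Finset.sum_add_distrib]
  have : ∀ i, (flip t i).val + (t i).val = 1 := by
    intro i
    have : t i = 0 ∨ t i = 1 := by omega
    rcases this with h | h <;> simp [flip, h]
  simp [this]

theorem eq_const_one {k : ℕ} {t : Fin k → Fin 2} (h : wt t = k) : t = fun _ => 1 := by
  have := eq_const_zero (t := flip t) (by have := wt_flip t; omega)
  rw [← flip_flip t, this]
  rfl

/-- The integral powers of `ζ²` that are trivial are those with exponent divisible by `D`. -/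
def HasDiam (ζ : Circle) (D : ℕ) : Prop := ∀ x : ℤ, ζ ^ (2 * x) = 1 ↔ (D : ℤ) ∣ x

/-- For even `n` the factor two cancels in `n ∣ 2x`; for odd `n` it is coprime to `n`. -/
theorem hasDiam_cyclic {n : ℕ} {ζ : Circle} (hζ : IsPrimitiveRoot ζ n) :
    HasDiam ζ (cycDiam n) := by
  intro x
  rw [hζ.zpow_eq_one_iff_dvd, cycDiam]
  split_ifs with h
  · obtain ⟨m, rfl⟩ := h
    rw [show (m + m) / 2 = m by omega]
    push_cast
    rw [← two_mul]
    exact mul_dvd_mul_iff_left two_ne_zero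
  · have : IsCoprime (n : ℤ) 2 := by
      rw [Int.isCoprime_iff_gcd_eq_one]
      exact (Nat.coprime_two_right.2 (Nat.not_even_iff_odd.1 h))
    exact ⟨this.dvd_of_dvd_mul_left, fun h => h.mul_left 2⟩

theorem hasDiam_dihedral {n : ℕ} {ζ : Circle} (hζ : IsPrimitiveRoot ζ (2 * n)) :
    HasDiam ζ n := by
  intro x
  rw [hζ.zpow_eq_one_iff_dvd]
  push_cast
  exact mul_dvd_mul_iff_left two_ne_zero

theorem HasDiam.zpow_eq {ζ : Circle} {D : ℕ} (h : HasDiam ζ D) (a b k : ℤ) :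
    ζ ^ (2 * a - k) = ζ ^ (2 * b - k) ↔ (D : ℤ) ∣ a - b := by
  rw [← h, ← mul_inv_eq_one, ← zpow_neg, ← zpow_add]
  congr! 2
  ring

theorem HasDiam.dvd_of_repr_ne_zero {ζ : Circle} {D : ℕ} (h : HasDiam ζ D) {k : ℕ} {x : TPow k}
    {a : ℤ} (hx : tensorAction k (gMat ζ) x = ((ζ ^ (2 * a - k) : Circle) : ℂ) • x)
    {t : Fin k → Fin 2} (ht : (vecBasis k).repr x t ≠ 0) : (D : ℤ) ∣ wt t - a := by
  have := repr_gMat ζ x t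
  rw [hx, map_smul, Finsupp.smul_apply, smul_eq_mul] at this
  have := mul_right_cancel₀ ht this
  exact (h.zpow_eq _ _ k).1 (Circle.coe_injective this).symm

/-- An operator commuting with `g` preserves its eigenspaces. This bounds the centralizer algebras
from above. -/
theorem HasDiam.dvd_of_commute {ζ : Circle} {D : ℕ} (h : HasDiam ζ D) {k : ℕ}
    {f : Module.End ℂ (TPow k)}
    (hf : tensorAction k (gMat ζ) * f = f * tensorAction k (gMat ζ)) {s t : Fin k → Fin 2}
    (ht : (vecBasis k).repr (f (vec s)) t ≠ 0) : (D : ℤ) ∣ (wt t : ℤ) - wt s := by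
  refine h.dvd_of_repr_ne_zero ?_ ht
  rw [← Module.End.mul_apply, hf, Module.End.mul_apply, gMat_vec, map_smul]

/-! ### Membership in the centralizer algebras -/

theorem tensorAction_mul (k : ℕ) (A B : SU2) :
    tensorAction k (A * B) = tensorAction k A * tensorAction k B := by
  rw [tensorAction, tensorAction, tensorAction, ← PiTensorProduct.map_mul]
  simp [Matrix.toLin'_mul, Module.End.mul_eq_comp]

theorem tensorAction_one (k : ℕ) : tensorAction k 1 = 1 := by
  simp only [tensorAction, OneMemClass.coe_one, Matrix.toLin'_one]
  exact PiTensorProduct.map_one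

theorem mem_centralizerAlgebra_closure {S : Set SU2} {k : ℕ} {f : Module.End ℂ (TPow k)} :
    f ∈ centralizerAlgebra (Subgroup.closure S) k ↔
      ∀ A ∈ S, tensorAction k A * f = f * tensorAction k A := by
  rw [centralizerAlgebra, Subalgebra.mem_centralizer_iff]
  constructor
  · exact fun H A hA => H _ ⟨A, Subgroup.subset_closure hA, rfl⟩
  · rintro H _ ⟨A, hA, rfl⟩
    induction hA using Subgroup.closure_induction with
    | mem A hA => exact H A hA
    | one => rw [tensorAction_one, one_mul, mul_one]
    | mul A B _ _ h1 h2 => rw [tensorAction_mul, mul_assoc, h2, ← mul_assoc, h1, mul_assoc]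
    | inv A _ h =>
      have h1 : tensorAction k A⁻¹ * tensorAction k A = 1 := by
        rw [← tensorAction_mul, inv_mul_cancel, tensorAction_one]
      have h2 : tensorAction k A * tensorAction k A⁻¹ = 1 := by
        rw [← tensorAction_mul, mul_inv_cancel, tensorAction_one]
      calc tensorAction k A⁻¹ * f
          = tensorAction k A⁻¹ * (f * tensorAction k A) * tensorAction k A⁻¹ := by
            rw [mul_assoc, mul_assoc, h2, mul_one]
        _ = f * tensorAction k A⁻¹ := by rw [← h, ← mul_assoc, h1, one_mul]

theorem mem_centralizer_cyclic {ζ : Circle} {k : ℕ} {f : Module.End ℂ (TPow k)} :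
    f ∈ centralizerAlgebra (cyclicGroup ζ) k ↔
      tensorAction k (gMat ζ) * f = f * tensorAction k (gMat ζ) := by
  rw [cyclicGroup, Subgroup.zpowers_eq_closure, mem_centralizerAlgebra_closure]
  simp

theorem mem_centralizer_dihedral {ζ : Circle} {k : ℕ} {f : Module.End ℂ (TPow k)} :
    f ∈ centralizerAlgebra (dihedralGroup ζ) k ↔
      tensorAction k (gMat ζ) * f = f * tensorAction k (gMat ζ) ∧
      tensorAction k hMat * f = f * tensorAction k hMat := by
  rw [dihedralGroup, mem_centralizerAlgebra_closure]
  simp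

theorem gMat_mul_matUnit {ζ : Circle} {D : ℕ} (h : HasDiam ζ D) {k : ℕ} {r s : Fin k → Fin 2}
    (hrs : (D : ℤ) ∣ (wt r : ℤ) - wt s) :
    tensorAction k (gMat ζ) * matUnit r s = matUnit r s * tensorAction k (gMat ζ) := by
  refine end_ext fun t => ?_
  rw [Module.End.mul_apply, Module.End.mul_apply, gMat_vec, map_smul, matUnit_vec]
  split_ifs with ht
  · subst ht
    rw [gMat_vec, (h.zpow_eq _ _ k).2 hrs]
  · simp

theorem hMat_mul_matUnit {k : ℕ} (r s : Fin k → Fin 2) :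
    tensorAction k hMat * matUnit r s = matUnit (flip r) (flip s) * tensorAction k hMat := by
  refine end_ext fun t => ?_
  rw [Module.End.mul_apply, Module.End.mul_apply, hMat_vec, map_smul, matUnit_vec, matUnit_vec]
  have : flip t = flip s ↔ t = s :=
    ⟨fun h => by rw [← flip_flip t, h, flip_flip], fun h => by rw [h]⟩
  simp only [this]
  split_ifs
  · rw [hMat_vec]
  · simp

theorem matUnit_mul {k : ℕ} (r s t u : Fin k → Fin 2) :
    matUnit r s * matUnit t u = if s = t then matUnit r u else 0 := by
  refine end_ext fun x => ?_
  rw [Module.End.mul_apply, matUnit_vec]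
  by_cases h : x = u
  · rw [if_pos h, matUnit_vec]
    by_cases h' : s = t
    · rw [if_pos h', if_pos h'.symm, matUnit_vec, if_pos h]
    · rw [if_neg h', if_neg (Ne.symm h')]; rfl
  · rw [if_neg h, map_zero]
    split_ifs
    · rw [matUnit_vec, if_neg h]
    · rfl

theorem gMat_mul_matUnit_const {ζ : Circle} {D : ℕ} (h : HasDiam ζ D) (a b : Fin 2) :
    tensorAction D (gMat ζ) * matUnit (fun _ => a) (fun _ => b) =
      matUnit (fun _ => a) (fun _ => b) * tensorAction D (gMat ζ) := by
  apply gMat_mul_matUnit h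
  rw [wt_const, wt_const]
  push_cast
  exact (dvd_mul_right _ _).sub (dvd_mul_right _ _)

theorem apply_of_mem_range {k : ℕ} {f : Module.End ℂ (TPow k)} (hf : f * f = f) {x : TPow k}
    (hx : x ∈ LinearMap.range f) : f x = x := by
  obtain ⟨y, rfl⟩ := hx
  rw [← Module.End.mul_apply, hf]

theorem range_le_of_vec {k : ℕ} {f : Module.End ℂ (TPow k)} {W : Submodule ℂ (TPow k)}
    (h : ∀ t, f (vec t) ∈ W) : LinearMap.range f ≤ W := by
  rw [LinearMap.range_eq_map, ← (vecBasis k).span_eq, Submodule.map_span_le]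
  rintro _ ⟨t, rfl⟩
  simpa using h t

/-! ### The projections of the cyclic case -/

/-- Weights lie between `0` and `j < D`, so a constant sequence is the only one in its class modulo
`D`. Hence the range is the line of its simple tensor, and commutation with `g` forces `f` to kill
all the others. -/
theorem eq_matUnit_of_cyclic {ζ : Circle} {D : ℕ} (hD : HasDiam ζ D) {j : ℕ} (hj : j < D)
    {s : Fin 2} {f : Module.End ℂ (TPow j)}
    (hf : IsProjectionOnto (cyclicGroup ζ) j (IsCyclicSimple ζ (sgn s * j)) f) :
    f = matUnit (fun _ => s) (fun _ => s) := by
  obtain ⟨w, hw0, hW, hgw⟩ := hf.range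
  have hcomm := mem_centralizer_cyclic.1 hf.mem
  have hs : s = 0 ∨ s = 1 := by omega
  have hconst (t : Fin j → Fin 2) (h : (D : ℤ) ∣ (wt t : ℤ) - (j * s.val : ℕ)) :
      t = fun _ => s := by
    have := wt_le t
    rcases hs with rfl | rfl
    · refine eq_const_zero ?_
      have := Int.eq_zero_of_abs_lt_dvd h (by rw [abs_lt]; constructor <;> simp <;> omega)
      simpa using this
    · refine eq_const_one ?_
      have := Int.eq_zero_of_abs_lt_dvd h (by rw [abs_lt]; constructor <;> simp <;> omega)
      simp at this; omega
  -- The exponent `±j` is rewritten as `2a - j`, where `a = j * s` is the weight of the constant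
  -- sequence.
  have hg : tensorAction j (gMat ζ) w =
      ((ζ ^ (2 * ((j * s.val : ℕ) : ℤ) - j) : Circle) : ℂ) • w := by
    rw [hgw]
    congr 3
    rcases hs with rfl | rfl <;> simp [sgn]
    ring
  have hsupp (t : Fin j → Fin 2) (ht : t ≠ fun _ => s) : (vecBasis j).repr w t = 0 := by
    by_contra h
    exact ht (hconst t (hD.dvd_of_repr_ne_zero hg h))
  have hw : w = (vecBasis j).repr w (fun _ => s) • vec fun _ => s := by
    refine repr_ext fun t => ?_
    rw [map_smul, repr_vec, Finsupp.smul_apply, Finsupp.single_apply]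
    split_ifs with h
    · simp [← h]
    · simp [hsupp t (Ne.symm h)]
  have hc : (vecBasis j).repr w (fun _ => s) ≠ 0 := by
    intro h
    rw [h, zero_smul] at hw
    exact hw0 hw
  refine end_ext fun t => ?_
  rw [matUnit_vec]
  split_ifs with ht
  · rw [ht]
    refine apply_of_mem_range hf.idem ?_
    rw [hW, Submodule.mem_span_singleton]
    refine ⟨((vecBasis j).repr w fun _ => s)⁻¹, ?_⟩
    conv_lhs => rw [hw]
    rw [map_smul, repr_vec, smul_smul]
    simp [hc]
  · have hmem : f (vec t) ∈ LinearMap.range f := ⟨_, rfl⟩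
    rw [hW, Submodule.mem_span_singleton] at hmem
    obtain ⟨c, hcw⟩ := hmem
    refine repr_ext fun r => ?_
    by_contra hne
    rw [map_zero, Finsupp.zero_apply] at hne
    have hr : r = fun _ => s := by
      by_contra hr
      rw [← hcw, map_smul, Finsupp.smul_apply, hsupp r hr] at hne
      simp at hne
    have := hD.dvd_of_commute hcomm hne
    rw [hr, wt_const] at this
    exact ht (hconst t (by rw [← dvd_neg, neg_sub]; exact this))

theorem isCyclicFamily_matUnit {n : ℕ} {ζ : Circle} (hD : HasDiam ζ (cycDiam n)) :
    IsCyclicFamily n ζ fun _ s => matUnit (fun _ => s) (fun _ => s) where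
  proj j s _ := by
    refine ⟨mem_centralizer_cyclic.2 (gMat_mul_matUnit hD (by simp)), ?_,
      vec fun _ => s, vec_ne_zero _, ?_, ?_⟩
    · rw [matUnit_mul, if_pos rfl]
    · refine le_antisymm (range_le_of_vec fun t => ?_) ?_
      · rw [matUnit_vec]
        split_ifs
        · exact Submodule.mem_span_singleton_self _
        · exact Submodule.zero_mem _
      · rw [Submodule.span_singleton_le_iff_mem]
        exact ⟨vec fun _ => s, by rw [matUnit_vec, if_pos rfl]⟩
    · rw [gMat_vec, wt_const]
      congr 3
      have hs : s = 0 ∨ s = 1 := by omega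
      rcases hs with rfl | rfl <;> simp [sgn]
      ring
  top s := rfl


/-! ### The projections of the binary dihedral case -/

/-- The projection onto the span of `v_{-1} ⊗ ⋯ ⊗ v_{-1}` and `v_1 ⊗ ⋯ ⊗ v_1`, for `k ≥ 1`. -/
def twoProj (k : ℕ) : Module.End ℂ (TPow k) :=
  matUnit (fun _ => 0) (fun _ => 0) + matUnit (fun _ => 1) (fun _ => 1)

/-- For `ε = ±1` the projection onto the line of `v_{-1} ⊗ ⋯ ⊗ v_{-1} + ε v_1 ⊗ ⋯ ⊗ v_1`. -/
def oneProj (k : ℕ) (ε : ℂ) : Module.End ℂ (TPow k) :=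
  (1 / 2 : ℂ) • (twoProj k +
    ε • (matUnit (fun _ => 0) (fun _ => 1) + matUnit (fun _ => 1) (fun _ => 0)))

theorem const_inj {k : ℕ} (hk : 1 ≤ k) {a b : Fin 2} :
    (fun _ : Fin k => a) = (fun _ => b) ↔ a = b :=
  ⟨fun h => congrFun h ⟨0, hk⟩, fun h => by rw [h]⟩

theorem twoProj_vec_const {k : ℕ} (hk : 1 ≤ k) (a : Fin 2) :
    twoProj k (vec fun _ => a) = vec fun _ => a := by
  rw [twoProj, LinearMap.add_apply, matUnit_vec, matUnit_vec]
  have : a = 0 ∨ a = 1 := by omega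
  rcases this with rfl | rfl <;> simp [const_inj hk]

theorem twoProj_vec_of_ne {k : ℕ} {t : Fin k → Fin 2} (h : ∀ a, t ≠ fun _ => a) :
    twoProj k (vec t) = 0 := by
  rw [twoProj, LinearMap.add_apply, matUnit_vec, matUnit_vec, if_neg (h 0), if_neg (h 1), add_zero]

theorem oneProj_vec_of_ne {k : ℕ} {t : Fin k → Fin 2} (h : ∀ a, t ≠ fun _ => a) (ε : ℂ) :
    oneProj k ε (vec t) = 0 := by
  simp [oneProj, twoProj_vec_of_ne h, matUnit_vec, h]

theorem oneProj_vec_zero {k : ℕ} (hk : 1 ≤ k) (ε : ℂ) :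
    oneProj k ε (vec fun _ => 0) = (1 / 2 : ℂ) • (vec (fun _ => 0) + ε • vec fun _ => 1) := by
  simp [oneProj, twoProj_vec_const hk, matUnit_vec, const_inj hk]

theorem oneProj_vec_one {k : ℕ} (hk : 1 ≤ k) (ε : ℂ) :
    oneProj k ε (vec fun _ => 1) = (1 / 2 : ℂ) • (vec (fun _ => 1) + ε • vec fun _ => 0) := by
  simp [oneProj, twoProj_vec_const hk, matUnit_vec, const_inj hk]

theorem eq_smul_vec {k : ℕ} {x : TPow k} {r : Fin k → Fin 2}
    (h : ∀ t, (vecBasis k).repr x t ≠ 0 → t = r) : x = (vecBasis k).repr x r • vec r := by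
  refine repr_ext fun t => ?_
  rw [map_smul, repr_vec, Finsupp.smul_apply, Finsupp.single_apply]
  split_ifs with hr
  · simp [← hr]
  · simpa using not_imp_comm.1 (h t) (Ne.symm hr)

/-- A nonconstant `t` has weight strictly between `0` and `k ≤ D`, hence congruent to neither `0`
nor `k`, while `f (vec t)` only involves constant sequences. This still applies for `k = D`. -/
theorem apply_vec_eq_zero_of_ne {ζ : Circle} {D : ℕ} (hD : HasDiam ζ D) {k : ℕ} (hk : k ≤ D)
    {f : Module.End ℂ (TPow k)}
    (hf : tensorAction k (gMat ζ) * f = f * tensorAction k (gMat ζ))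
    (hr : LinearMap.range f ≤ Submodule.span ℂ {vec fun _ => 0, vec fun _ => 1})
    {t : Fin k → Fin 2} (ht : ∀ a, t ≠ fun _ => a) : f (vec t) = 0 := by
  refine repr_ext fun r => ?_
  by_contra hne
  rw [map_zero, Finsupp.zero_apply] at hne
  have hdvd := hD.dvd_of_commute hf hne
  obtain ⟨a, b, hab⟩ := Submodule.mem_span_pair.1 (hr ⟨vec t, rfl⟩)
  have h0 : wt t ≠ 0 := fun h => ht _ (eq_const_zero h)
  have h1 : wt t ≠ k := fun h => ht _ (eq_const_one h)
  have hle := wt_le t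
  have hr : r = (fun _ => 0) ∨ r = fun _ => 1 := by
    by_contra! H
    apply hne
    rw [← hab, map_add, map_smul, map_smul, repr_vec, repr_vec]
    simp [H.1.symm, H.2.symm]
  rcases hr with rfl | rfl <;> rw [wt_const] at hdvd
  · have := Int.eq_zero_of_abs_lt_dvd hdvd (by rw [abs_lt]; constructor <;> simp <;> omega)
    simp at this; omega
  · have := Int.eq_zero_of_abs_lt_dvd hdvd (by rw [abs_lt]; constructor <;> simp <;> omega)
    simp at this; omega

/-- The eigenvalues `ζ ^ (-k)` and `ζ ^ k` belong to the weights `0` and `k`, which are isolated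
modulo `D` since `k < D`. So the two basis vectors of the range are multiples of the constant simple
tensors. -/
theorem eq_twoProj {ζ : Circle} {D : ℕ} (hD : HasDiam ζ D) {k : ℕ} (hk : 1 ≤ k) (hkD : k < D)
    {f : Module.End ℂ (TPow k)}
    (hf : IsProjectionOnto (dihedralGroup ζ) k (IsDihedralTwoDim ζ k) f) : f = twoProj k := by
  obtain ⟨u, w, hlin, hW, hu, hw, -, -⟩ := hf.range
  have hcomm := mem_centralizer_dihedral.1 hf.mem
  have hu' := eq_smul_vec (x := u) (r := fun _ => 0) fun t ht => by
    have := hD.dvd_of_repr_ne_zero (a := 0) (by rw [hu]; simp) ht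
    have := Int.eq_zero_of_abs_lt_dvd this (by have := wt_le t; simp; omega)
    exact eq_const_zero (by omega)
  have hw' := eq_smul_vec (x := w) (r := fun _ => 1) fun t ht => by
    have := hD.dvd_of_repr_ne_zero (a := k) (by rw [hw]; congr 3; ring) ht
    have hle := wt_le t
    have := Int.eq_zero_of_abs_lt_dvd this (by rw [abs_lt]; constructor <;> omega)
    exact eq_const_one (by omega)
  set a := (vecBasis k).repr u fun _ => 0
  set b := (vecBasis k).repr w fun _ => 1
  have ha : a ≠ 0 := by
    intro h
    rw [h, zero_smul] at hu'
    exact hlin.ne_zero 0 hu'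
  have hb : b ≠ 0 := by
    intro h
    rw [h, zero_smul] at hw'
    exact hlin.ne_zero 1 hw'
  have hle : LinearMap.range f ≤ Submodule.span ℂ {vec fun _ => 0, vec fun _ => 1} := by
    rw [hW, Submodule.span_le]
    rintro x (rfl | rfl)
    · rw [hu']; exact Submodule.smul_mem _ _ (Submodule.subset_span (by simp))
    · rw [hw']; exact Submodule.smul_mem _ _ (Submodule.subset_span (by simp))
  refine end_ext fun t => ?_
  by_cases h : ∀ c, t ≠ fun _ => c
  · rw [twoProj_vec_of_ne h, apply_vec_eq_zero_of_ne hD hkD.le hcomm.1 hle h]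
  · push Not at h
    obtain ⟨c, rfl⟩ := h
    rw [twoProj_vec_const hk]
    apply apply_of_mem_range hf.idem
    rw [hW]
    have : c = 0 ∨ c = 1 := by omega
    rcases this with rfl | rfl
    · rw [show vec (fun _ : Fin k => (0 : Fin 2)) = a⁻¹ • u by rw [hu', smul_smul]; simp [ha]]
      exact Submodule.smul_mem _ _ (Submodule.subset_span (by simp))
    · rw [show vec (fun _ : Fin k => (1 : Fin 2)) = b⁻¹ • w by rw [hw', smul_smul]; simp [hb]]
      exact Submodule.smul_mem _ _ (Submodule.subset_span (by simp))

theorem IsPrimitiveRoot.circle_pow_half {n : ℕ} (hn : 1 ≤ n) {ζ : Circle}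
    (hζ : IsPrimitiveRoot ζ (2 * n)) : (ζ : ℂ) ^ n = -1 := by
  have h : IsPrimitiveRoot (ζ : ℂ) (2 * n) :=
    hζ.map_of_injective (f := Circle.coeHom) Circle.coe_injective
  exact (h.pow (by omega) (mul_comm 2 n)).eq_neg_one_of_two_right

/-- The eigenvalue `-1 = ζ ^ n` of `g` only admits the weights `0` and `n`, and `h` fixes the ratio
of the two coefficients as `ε`. This determines the range; commutation with `h` and idempotence
determine `f` on it and on the constant tensors. -/
theorem eq_oneProj {n : ℕ} (hn : 1 ≤ n) {ζ : Circle} (hζ : IsPrimitiveRoot ζ (2 * n)) {ε : ℂ}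
    (hε : ε * ε = 1) {f : Module.End ℂ (TPow n)}
    (hf : IsProjectionOnto (dihedralGroup ζ) n (IsDihedralOneDim ζ (ε * Complex.I ^ n)) f) :
    f = oneProj n ε := by
  have hD := hasDiam_dihedral hζ
  obtain ⟨w, hw0, hW, hg, hh⟩ := hf.range
  have hcomm := mem_centralizer_dihedral.1 hf.mem
  have hI : Complex.I ^ n ≠ 0 := pow_ne_zero _ Complex.I_ne_zero
  have hsupp (t : Fin n → Fin 2) (ht : ∀ a, t ≠ fun _ => a) : (vecBasis n).repr w t = 0 := by
    by_contra hne
    have hdvd := hD.dvd_of_repr_ne_zero (a := n) (by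
      rw [hg, show (2 * n - n : ℤ) = n by ring, zpow_natCast, Circle.coe_pow,
        IsPrimitiveRoot.circle_pow_half hn hζ]
      exact (neg_one_smul ℂ w).symm) hne
    have h0 : wt t ≠ 0 := fun h => ht _ (eq_const_zero h)
    have h1 : wt t ≠ n := fun h => ht _ (eq_const_one h)
    have hle := wt_le t
    have := Int.eq_zero_of_abs_lt_dvd hdvd (by rw [abs_lt]; constructor <;> omega)
    omega
  -- Coefficients of `h w` are compared at the all-`v₋₁` sequence, which `h` exchanges with the
  -- all-`v₁` sequence up to `I ^ n`.
  have h1 : (vecBasis n).repr w (fun _ => 1) = ε * (vecBasis n).repr w fun _ => 0 := by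
    have := repr_hMat w (fun _ => 0)
    rw [hh, map_smul, Finsupp.smul_apply, smul_eq_mul, flip_const, sub_zero] at this
    refine mul_left_cancel₀ hI ?_
    rw [← this]; ring
  set c := (vecBasis n).repr w fun _ => 0 with hc
  have h01 : (fun _ : Fin n => (0 : Fin 2)) ≠ fun _ => 1 := by simp [const_inj hn]
  have hw : w = c • (vec (fun _ => 0) + ε • vec fun _ => 1) := by
    refine repr_ext fun t => ?_
    rw [map_smul, map_add, map_smul, repr_vec, repr_vec]
    by_cases h : ∀ a, t ≠ fun _ => a
    · rw [hsupp t h]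
      simp [(h 0).symm, (h 1).symm]
    · push Not at h
      obtain ⟨a, rfl⟩ := h
      have : a = 0 ∨ a = 1 := by omega
      rcases this with rfl | rfl
      · simp [h01.symm, c]
      · simp [h01, h1, mul_comm]
  have hc0 : c ≠ 0 := by
    intro h
    rw [h, zero_smul] at hw
    exact hw0 hw
  set q : TPow n := vec (fun _ => 0) + ε • vec fun _ => 1 with hq
  have hrange : LinearMap.range f = Submodule.span ℂ {q} := by
    rw [hW, hw]
    exact Submodule.span_singleton_smul_eq (IsUnit.mk0 _ hc0) _
  have hfq : f q = q := apply_of_mem_range hf.idem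
    (by rw [hrange]; exact Submodule.mem_span_singleton_self _)
  have hq0 : q ≠ 0 := by
    rintro h
    rw [h, smul_zero] at hw
    exact hw0 hw
  have hhq : tensorAction n hMat q = (ε * Complex.I ^ n) • q := by
    rw [hq, map_add, map_smul, hMat_vec, hMat_vec, flip_const, flip_const, sub_zero, sub_self,
      smul_add, smul_smul, smul_smul, mul_right_comm, hε, one_mul, add_comm]
  have hle : LinearMap.range f ≤ Submodule.span ℂ {vec fun _ => 0, vec fun _ => 1} := by
    rw [hrange, Submodule.span_singleton_le_iff_mem]
    exact Submodule.mem_span_pair.2 ⟨1, ε, by rw [one_smul]⟩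
  have hmem : f (vec fun _ => 0) ∈ LinearMap.range f := ⟨_, rfl⟩
  rw [hrange, Submodule.mem_span_singleton] at hmem
  obtain ⟨x, hx⟩ := hmem
  have hf1 : f (vec fun _ => 1) = (ε * x) • q := by
    have := LinearMap.congr_fun hcomm.2 (vec fun _ => 0)
    rw [Module.End.mul_apply, Module.End.mul_apply, ← hx, map_smul, hhq, hMat_vec, flip_const,
      sub_zero, map_smul] at this
    refine smul_right_injective _ hI ?_
    change Complex.I ^ n • f (vec fun _ => 1) = Complex.I ^ n • (ε * x) • q
    rw [← this, smul_smul, smul_smul]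
    congr 1; ring
  -- Since `f` fixes `q`, the relation `x + ε * (ε * x) = 1` holds, that is, `2x = 1`.
  have hx2 : x = 1 / 2 := by
    have : f q = (x + ε * (ε * x)) • q := by
      rw [add_smul, hx, mul_smul, ← hf1, ← map_smul, ← map_add]
    rw [hfq, ← mul_assoc, hε, one_mul] at this
    have := smul_left_injective ℂ hq0 ((one_smul ℂ q).trans this)
    linear_combination -(1 / 2 : ℂ) * this
  refine end_ext fun t => ?_
  by_cases h : ∀ c, t ≠ fun _ => c
  · rw [oneProj_vec_of_ne h, apply_vec_eq_zero_of_ne hD le_rfl hcomm.1 hle h]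
  · push Not at h
    obtain ⟨a, rfl⟩ := h
    have : a = 0 ∨ a = 1 := by omega
    rcases this with rfl | rfl
    · rw [oneProj_vec_zero hn, ← hx, hx2]
    · rw [oneProj_vec_one hn, hf1, hx2, hq, mul_comm, mul_smul, smul_add ε, smul_smul, hε,
        one_smul, add_comm]

/-! ### Existence -/

theorem isProjectionOnto_twoProj {ζ : Circle} {D : ℕ} (hD : HasDiam ζ D) {k : ℕ} (hk : 1 ≤ k) :
    IsProjectionOnto (dihedralGroup ζ) k (IsDihedralTwoDim ζ k) (twoProj k) := by
  have h01 : (fun _ : Fin k => (0 : Fin 2)) ≠ fun _ => 1 := by simp [const_inj hk]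
  refine ⟨mem_centralizer_dihedral.2 ⟨?_, ?_⟩, ?_, vec fun _ => 0, vec fun _ => 1, ?_, ?_, ?_, ?_,
    ?_, ?_⟩
  · rw [twoProj, mul_add, add_mul, gMat_mul_matUnit hD (by simp), gMat_mul_matUnit hD (by simp)]
  · rw [twoProj, mul_add, add_mul, hMat_mul_matUnit, hMat_mul_matUnit, flip_const, flip_const,
      sub_zero, sub_self, add_comm]
  · rw [twoProj, mul_add, add_mul, add_mul]
    simp [matUnit_mul, const_inj hk]
  · have := (vecBasis k).linearIndependent.comp ![fun _ => 0, fun _ => 1] (by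
      intro a b
      fin_cases a <;> fin_cases b <;> simp [h01, h01.symm])
    convert this using 1
    ext a
    fin_cases a <;> simp
  · refine le_antisymm (range_le_of_vec fun t => ?_) (Submodule.span_le.2 ?_)
    · rw [twoProj, LinearMap.add_apply, matUnit_vec, matUnit_vec]
      refine Submodule.add_mem _ ?_ ?_ <;> split_ifs <;>
        first | exact Submodule.zero_mem _ | exact Submodule.subset_span (by simp)
    · rintro x (rfl | rfl)
      · exact ⟨_, twoProj_vec_const hk 0⟩
      · exact ⟨_, twoProj_vec_const hk 1⟩
  · rw [gMat_vec, wt_const]; simp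
  · rw [gMat_vec, wt_const]; congr 3; simp; ring
  · rw [hMat_vec, flip_const, sub_zero]
  · rw [hMat_vec, flip_const, sub_self]

theorem isProjectionOnto_oneProj {n : ℕ} (hn : 1 ≤ n) {ζ : Circle}
    (hζ : IsPrimitiveRoot ζ (2 * n)) {ε : ℂ} (hε : ε * ε = 1) :
    IsProjectionOnto (dihedralGroup ζ) n (IsDihedralOneDim ζ (ε * Complex.I ^ n))
      (oneProj n ε) := by
  have hD := hasDiam_dihedral hζ
  have hq : oneProj n ε (vec (fun _ => 0) + ε • vec fun _ => 1) =
      vec (fun _ => 0) + ε • vec fun _ => 1 := by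
    rw [map_add, map_smul, oneProj_vec_zero hn, oneProj_vec_one hn, smul_comm, smul_add ε,
      smul_smul, hε]
    module
  have hvec (t : Fin n → Fin 2) : ∃ c : ℂ,
      oneProj n ε (vec t) = c • (vec (fun _ => 0) + ε • vec fun _ => 1) := by
    by_cases h : ∀ c, t ≠ fun _ => c
    · exact ⟨0, by rw [oneProj_vec_of_ne h, zero_smul]⟩
    · push Not at h
      obtain ⟨a, rfl⟩ := h
      have : a = 0 ∨ a = 1 := by omega
      rcases this with rfl | rfl
      · exact ⟨1 / 2, oneProj_vec_zero hn ε⟩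
      · refine ⟨1 / 2 * ε, ?_⟩
        rw [oneProj_vec_one hn, mul_smul, smul_add ε, smul_smul, hε, one_smul, add_comm]
  refine ⟨mem_centralizer_dihedral.2 ⟨?_, ?_⟩, ?_, vec (fun _ => 0) + ε • vec fun _ => 1, ?_, ?_,
    ?_, ?_⟩
  · simp only [oneProj, twoProj, mul_add, add_mul, mul_smul_comm, smul_mul_assoc,
      gMat_mul_matUnit_const hD]
  · simp only [oneProj, twoProj, mul_add, add_mul, mul_smul_comm, smul_mul_assoc,
      hMat_mul_matUnit, flip_const, sub_zero, sub_self]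
    module
  · refine end_ext fun t => ?_
    obtain ⟨c, hc⟩ := hvec t
    rw [Module.End.mul_apply, hc, map_smul, hq]
  · intro h
    have := congrArg (fun x => (vecBasis n).repr x fun _ => 0) h
    simp [const_inj hn] at this
  · refine le_antisymm (range_le_of_vec fun t => ?_) ?_
    · obtain ⟨c, hc⟩ := hvec t
      rw [hc]
      exact Submodule.smul_mem _ _ (Submodule.mem_span_singleton_self _)
    · rw [Submodule.span_singleton_le_iff_mem]
      exact ⟨_, hq⟩
  · have h1 (m : ℤ) (h : (n : ℤ) ∣ m - n) : ((ζ ^ (2 * m - n : ℤ) : Circle) : ℂ) = -1 := by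
      rw [(hD.zpow_eq m n n).2 h, show (2 * n - n : ℤ) = n by ring, zpow_natCast, Circle.coe_pow,
        IsPrimitiveRoot.circle_pow_half hn hζ]
    rw [map_add, map_smul, gMat_vec, gMat_vec, wt_const, wt_const, h1 _ (by simp), h1 _ (by simp)]
    module
  · rw [map_add, map_smul, hMat_vec, hMat_vec, flip_const, flip_const, sub_zero, sub_self,
      smul_add, smul_smul, smul_smul, mul_right_comm, hε, one_mul, add_comm]

theorem exists_isDihedralFamily {n : ℕ} (hn : 1 ≤ n) {ζ : Circle}
    (hζ : IsPrimitiveRoot ζ (2 * n)) :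
    ∃ (b : (j : ℕ) → Module.End ℂ (TPow (j + 1))) (b' : Module.End ℂ (TPow n)),
      IsDihedralFamily n ζ b b' := by
  -- For `j + 1 > n` no condition is imposed, so the value there is immaterial.
  refine ⟨fun j => if j + 1 = n then oneProj (j + 1) 1 else twoProj (j + 1), oneProj n (-1),
    fun j hj => ?_, fun j hj => ?_, ?_⟩
  · rw [if_neg (by omega)]
    exact isProjectionOnto_twoProj (hasDiam_dihedral hζ) (by omega)
  · subst hj
    rw [if_pos rfl]
    simpa using isProjectionOnto_oneProj (ε := 1) hn hζ (by norm_num)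
  · simpa using isProjectionOnto_oneProj (ε := -1) hn hζ (by norm_num)


section


variable {N : ℕ}

/-! ### The relations of the cyclic case -/

theorem IsCyclicFamily.eq_matUnit {n : ℕ} {ζ : Circle} (hD : HasDiam ζ (cycDiam n))
    {b : (j : ℕ) → Fin 2 → Module.End ℂ (TPow j)} (hb : IsCyclicFamily n ζ b) {j : ℕ}
    (hj : j ≤ cycDiam n) (s : Fin 2) : b j s = matUnit (fun _ => s) (fun _ => s) := by
  rcases hj.lt_or_eq with h | rfl
  · exact eq_matUnit_of_cyclic hD h (hb.proj j s hj)
  · exact hb.top s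

theorem cycDiam_pos {n : ℕ} (hn : 1 ≤ n) : 1 ≤ cycDiam n := by
  rw [cycDiam]
  split_ifs with h
  · obtain ⟨m, rfl⟩ := h; omega
  · exact hn

theorem cycUnit_eq {n : ℕ} {b : (j : ℕ) → Fin 2 → Module.End ℂ (TPow j)}
    (hb : ∀ s, b (cycDiam n) s = matUnit (fun _ => s) (fun _ => s)) (δ γ : Fin 2) :
    cycUnit n N b δ γ = prefixUnit N (cycDiam n) δ γ := by
  rw [cycUnit, prefixUnit]
  split_ifs with h
  · rw [hb, h]
  · rfl

theorem cyclicRelations {n : ℕ} (hn : 1 ≤ n) (hN : cycDiam n ≤ N)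
    {b : (j : ℕ) → Fin 2 → Module.End ℂ (TPow j)}
    (hb : ∀ j s, j ≤ cycDiam n → b j s = matUnit (fun _ => s) (fun _ => s)) :
    CyclicRelations n N b := by
  have hD := cycDiam_pos hn
  have hU (j : ℕ) (s : Fin 2) (hj : j ≤ cycDiam n) : emb N (b j s) = prefixUnit N j s s := by
    rw [hb j s hj, prefixUnit]
  have hC := cycUnit_eq (N := N) fun s => hb (cycDiam n) s le_rfl
  refine ⟨fun s => ⟨fun i => e_sq, fun i => e_mul_e_mul_e, fun i j => e_comm,
    fun i j hij hj => ?_, fun j hj hj' => ?_, fun i j hj hi hij => ?_, fun i j hj hij hi => ?_,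
    fun j hj hj' hjN => ?_⟩, fun s => ?_, fun i j s t hi hi' hj hj' hst => ?_,
    fun γ δ η θ => ?_, fun j α γ δ hj hj' h => ?_, fun j α γ δ hj hj' h => ?_⟩
  · simp only [hU j s hj, hU i s (hij.trans hj)]
    -- `b_0` is the identity and falls outside the product rules, which need a nonempty prefix.
    rcases Nat.eq_zero_or_pos i with rfl | hi
    · simp [prefixUnit_zero]
    · rw [prefixUnit_mul_of_le_left hi hij (hj.trans hN), if_pos rfl,
        prefixUnit_mul_of_le_right hi hij (hj.trans hN), if_pos rfl]
      exact ⟨rfl, rfl⟩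
  · simp only [hU (j + 1) s hj', hU j s (by omega), zero_add, div_one, one_smul]
    rw [prefixUnit_mul_e_mul_self hj (by omega)]
    abel
  · simp only [hU j s hj]
    exact ⟨e_mul_prefixUnit_of_lt hi (by omega) (hj.trans hN) _ _,
      prefixUnit_mul_e_of_lt hi (by omega) (hj.trans hN) _ _⟩
  · simp only [hU j s hj]
    exact e_comm_prefixUnit (by omega) hi _ _
  · simp only [hU j s hj', hU (j - 1) s (by omega), zero_add, div_one, one_smul] at hjN ⊢
    rw [e_mul_prefixUnit_mul_e hj hjN, if_pos rfl]
  · rw [hU _ _ le_rfl, prefixUnit_mul hD hN, if_pos rfl]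
  · rw [hU i s hi', hU j t hj']
    rcases le_total i j with h | h
    · rw [prefixUnit_mul_of_le_left hi h (hj'.trans hN), if_neg hst]
    · rw [prefixUnit_mul_of_le_right hj h (hi'.trans hN), if_neg hst.symm]
  · rw [hC, hC, prefixUnit_mul hD hN, hC]
  · rw [hU j α hj'.le, hC, prefixUnit_mul_of_le_left hj hj'.le hN]
  · rw [hU j α hj'.le, hC, prefixUnit_mul_of_le_right hj hj'.le hN]

/-! ### The relations of the binary dihedral case -/

/-- The projection `twoProj j` acting on the first `j` factors. -/
def prefixTwo (N j : ℕ) : Module.End ℂ (TPow N) := prefixUnit N j 0 0 + prefixUnit N j 1 1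

/-- The projection `oneProj j ε` acting on the first `j` factors. -/
def prefixOne (N j : ℕ) (ε : ℂ) : Module.End ℂ (TPow N) :=
  (1 / 2 : ℂ) • (prefixTwo N j + ε • (prefixUnit N j 0 1 + prefixUnit N j 1 0))

theorem emb_twoProj (j : ℕ) : emb N (twoProj j) = prefixTwo N j := emb_add _ _

theorem emb_oneProj (j : ℕ) (ε : ℂ) : emb N (oneProj j ε) = prefixOne N j ε := by
  rw [oneProj, emb_smul, emb_add, emb_smul, emb_add, emb_twoProj]; rfl

variable {i j : ℕ}

theorem prefixTwo_mul (hi : 1 ≤ i) (hij : i ≤ j) (hN : j ≤ N) :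
    prefixTwo N i * prefixTwo N j = prefixTwo N j := by
  simp [prefixTwo, mul_add, add_mul, prefixUnit_mul_of_le_left hi hij hN]

theorem prefixTwo_mul' (hi : 1 ≤ i) (hij : i ≤ j) (hN : j ≤ N) :
    prefixTwo N j * prefixTwo N i = prefixTwo N j := by
  simp [prefixTwo, mul_add, add_mul, prefixUnit_mul_of_le_right hi hij hN]

theorem prefixTwo_mul_prefixOne (hi : 1 ≤ i) (hij : i ≤ j) (hN : j ≤ N) (ε : ℂ) :
    prefixTwo N i * prefixOne N j ε = prefixOne N j ε := by
  rw [prefixOne, mul_smul_comm, mul_add, prefixTwo_mul hi hij hN, mul_smul_comm]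
  simp [prefixTwo, mul_add, add_mul, prefixUnit_mul_of_le_left hi hij hN]

theorem prefixOne_mul_prefixTwo (hi : 1 ≤ i) (hij : i ≤ j) (hN : j ≤ N) (ε : ℂ) :
    prefixOne N j ε * prefixTwo N i = prefixOne N j ε := by
  rw [prefixOne, smul_mul_assoc, add_mul, prefixTwo_mul' hi hij hN, smul_mul_assoc]
  simp [prefixTwo, mul_add, add_mul, prefixUnit_mul_of_le_right hi hij hN, add_comm]

/-- With `X` the sum of the off-diagonal units and `prefixTwo` as unit, `X² = 1`, so this is `(1 +
εX)(1 + δX)` up to the factor `1/4`. It gives idempotence for `ε = δ = ±1` and orthogonality for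
opposite signs. -/
theorem prefixOne_mul_prefixOne (hj : 1 ≤ j) (hN : j ≤ N) (ε δ : ℂ) :
    prefixOne N j ε * prefixOne N j δ = (1 / 4 : ℂ) • ((1 + ε * δ) • prefixTwo N j +
      (ε + δ) • (prefixUnit N j 0 1 + prefixUnit N j 1 0)) := by
  simp only [prefixOne, prefixTwo, mul_add, add_mul, smul_mul_assoc, mul_smul_comm,
    prefixUnit_mul hj hN, if_true, zero_ne_one, one_ne_zero, if_false, add_zero, zero_add]
  module

theorem prefixOne_idem (hj : 1 ≤ j) (hN : j ≤ N) {ε : ℂ} (hε : ε * ε = 1) :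
    prefixOne N j ε * prefixOne N j ε = prefixOne N j ε := by
  rw [prefixOne_mul_prefixOne hj hN, hε, prefixOne]
  module

theorem prefixOne_add (j : ℕ) : prefixOne N j 1 + prefixOne N j (-1) = prefixTwo N j := by
  rw [prefixOne, prefixOne]
  module

/-- The mixed terms vanish because `j ≥ 2`; the two diagonal terms are the cyclic recursion. -/
theorem prefixTwo_mul_e_mul (hj : 2 ≤ j) (hN : j < N) :
    prefixTwo N j * e N j * prefixTwo N j = prefixTwo N j - prefixTwo N (j + 1) := by
  have h := prefixUnit_mul_e_mul_self (N := N) (show 1 ≤ j by omega) hN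
  have h01 := prefixUnit_mul_e_mul_prefixUnit_of_ne hj hN (α := 0) (δ := 1) zero_ne_one
  have h10 := prefixUnit_mul_e_mul_prefixUnit_of_ne hj hN (α := 1) (δ := 0) one_ne_zero
  simp only [prefixTwo, mul_add, add_mul, h, h01, h10]
  abel

theorem e_mul_prefixTwo_mul_e (hj : 1 ≤ j) (hN : j < N) :
    e N j * prefixTwo N j * e N j = prefixTwo N (j - 1) * e N j := by
  simp [prefixTwo, mul_add, add_mul, e_mul_prefixUnit_mul_e hj hN]

/-- The off-diagonal units contribute nothing between two `e_j`, so the result is independent of `ε`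
and serves both `b_{n-1}` and `b'`. -/
theorem e_mul_prefixOne_mul_e (hj : 1 ≤ j) (hN : j < N) (ε : ℂ) :
    e N j * prefixOne N j ε * e N j = (1 / 2 : ℂ) • (prefixTwo N (j - 1) * e N j) := by
  rw [prefixOne, mul_smul_comm, smul_mul_assoc, mul_add, add_mul, e_mul_prefixTwo_mul_e hj hN]
  simp [mul_add, add_mul, e_mul_prefixUnit_mul_e hj hN]

/-- The coefficients of `2p` are `c α β = ε ^ (α + β)`, and `c α β * c β δ = c α δ` because `ε² =
1`. Summing `u α β * x * u β δ` over `β` therefore turns `p * x * p` into half of `p`. -/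
theorem eq_two_smul_mul_mul_of_matrix_units {R : Type*} [Semiring R] [Algebra ℂ R]
    (u : Fin 2 → Fin 2 → R) (x : R) {ε : ℂ} (hε : ε * ε = 1)
    (h : ∀ α δ, u α 0 * x * u 0 δ + u α 1 * x * u 1 δ = u α δ)
    (h01 : ∀ α δ, u α 0 * x * u 1 δ = 0) (h10 : ∀ α δ, u α 1 * x * u 0 δ = 0) (p : R)
    (hp : p = (1 / 2 : ℂ) • (u 0 0 + u 1 1 + ε • (u 0 1 + u 1 0))) :
    p = (2 : ℂ) • (p * x * p) := by
  have key : p = (1 / 2 : ℂ) • ((u 0 0 * x * u 0 0 + u 0 1 * x * u 1 0) +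
      (u 1 0 * x * u 0 1 + u 1 1 * x * u 1 1) + ε • ((u 0 0 * x * u 0 1 + u 0 1 * x * u 1 1) +
        (u 1 0 * x * u 0 0 + u 1 1 * x * u 1 0))) := by simp only [h, hp]
  conv_lhs => rw [key]
  simp only [hp, mul_add, add_mul, smul_mul_assoc, mul_smul_comm, h01, h10, add_zero, zero_add]
  rcases mul_self_eq_one_iff.1 hε with rfl | rfl <;> module

theorem prefixOne_mul_e_mul (hj : 2 ≤ j) (hN : j < N) {ε : ℂ} (hε : ε * ε = 1) :
    prefixOne N j ε = (2 : ℂ) • (prefixOne N j ε * e N j * prefixOne N j ε) :=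
  eq_two_smul_mul_mul_of_matrix_units (prefixUnit N j) (e N j) hε
    (prefixUnit_mul_e_mul_sum (by omega) hN)
    (fun _ _ => prefixUnit_mul_e_mul_prefixUnit_of_ne hj hN zero_ne_one)
    (fun _ _ => prefixUnit_mul_e_mul_prefixUnit_of_ne hj hN one_ne_zero) _ rfl

theorem e_mul_prefixTwo (hi : 1 ≤ i) (hij : i < j) (hN : j ≤ N) :
    e N i * prefixTwo N j = 0 ∧ prefixTwo N j * e N i = 0 := by
  simp [prefixTwo, mul_add, add_mul, e_mul_prefixUnit_of_lt hi hij hN,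
    prefixUnit_mul_e_of_lt hi hij hN]

theorem e_mul_prefixOne (hi : 1 ≤ i) (hij : i < j) (hN : j ≤ N) (ε : ℂ) :
    e N i * prefixOne N j ε = 0 ∧ prefixOne N j ε * e N i = 0 := by
  simp [prefixOne, mul_add, add_mul, e_mul_prefixUnit_of_lt hi hij hN,
    prefixUnit_mul_e_of_lt hi hij hN, e_mul_prefixTwo hi hij hN]

theorem e_comm_prefixTwo (hij : j < i) (hN : i < N) :
    e N i * prefixTwo N j = prefixTwo N j * e N i := by
  simp only [prefixTwo, mul_add, add_mul, e_comm_prefixUnit hij hN]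

theorem e_comm_prefixOne (hij : j < i) (hN : i < N) (ε : ℂ) :
    e N i * prefixOne N j ε = prefixOne N j ε * e N i := by
  simp only [prefixOne, mul_add, add_mul, mul_smul_comm, smul_mul_assoc, e_comm_prefixUnit hij hN,
    e_comm_prefixTwo hij hN]

theorem dihedralRelations {n : ℕ} (hn : 2 ≤ n) (hN : n ≤ N)
    {b : (j : ℕ) → Module.End ℂ (TPow (j + 1))} {b' : Module.End ℂ (TPow n)}
    (hb : ∀ j, j + 1 < n → emb N (b j) = prefixTwo N (j + 1))
    (htop : emb N (b (n - 1)) = prefixOne N n 1) (hb' : emb N b' = prefixOne N n (-1)) :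
    DihedralRelations n N b b' := by
  have h11 : (1 : ℂ) * 1 = 1 := one_mul 1
  have hmm : (-1 : ℂ) * -1 = 1 := by norm_num
  have hd1 : dihDim n (n - 1) = 1 := by rw [dihDim, if_pos (by omega)]
  have hd2 (j : ℕ) (hj : j + 1 < n) : dihDim n j = 2 := by rw [dihDim, if_neg (by omega)]
  have hlast : emb N (b (n - 2)) = prefixTwo N (n - 1) := by
    rw [hb (n - 2) (by omega), show n - 2 + 1 = n - 1 by omega]
  have hcases (j : ℕ) (hj : j ≤ n - 1) : j + 1 < n ∨ j = n - 1 := by omega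
  have horth (ε δ : ℂ) (h : ε * δ = -1) (h' : ε + δ = 0) :
      prefixOne N n ε * prefixOne N n δ = 0 := by
    rw [prefixOne_mul_prefixOne (by omega) hN, h, h']
    simp
  refine ⟨⟨fun i => e_sq, fun i => e_mul_e_mul_e, fun i j => e_comm, fun i j hij hj => ?_,
    fun j hj hj' => ?_, fun i j hj hi hij => ?_, fun i j hj hij hi => ?_, fun j hj hj' hjN => ?_⟩,
    fun h3 => ?_, fun h => ?_, fun j hj hj' => ?_, ?_, ⟨?_, ?_⟩, fun h => ?_, fun i hi hi' => ?_,
    fun i hi hi' => ?_, fun h => ?_, fun h => ?_⟩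
  · rcases hcases j hj with h | rfl
    · simp only [hb j h, hb i (by omega)]
      exact ⟨prefixTwo_mul (by omega) (by omega) (by omega),
        prefixTwo_mul' (by omega) (by omega) (by omega)⟩
    · rcases hcases i hij with h' | rfl
      · simp only [hb i h', htop]
        exact ⟨prefixTwo_mul_prefixOne (by omega) (by omega) hN _,
          prefixOne_mul_prefixTwo (by omega) (by omega) hN _⟩
      · simp only [htop]
        exact ⟨prefixOne_idem (by omega) hN h11, prefixOne_idem (by omega) hN h11⟩
  · simp only [hb j (by omega), hb (j + 1) (by omega), hd2 j (by omega), hd2 (j - 1) (by omega)]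
    rw [add_comm 1 j, prefixTwo_mul_e_mul (by omega) (by omega), div_self two_ne_zero, one_smul]
    abel
  · rcases hcases j hj with h | rfl
    · simp only [hb j h]
      exact e_mul_prefixTwo hi (by omega) (by omega)
    · simp only [htop]
      exact e_mul_prefixOne hi (by omega) hN _
  · rcases hcases j hj with h | rfl
    · simp only [hb j h]
      exact e_comm_prefixTwo (by omega) hi
    · simp only [htop]
      exact e_comm_prefixOne (by omega) hi _
  · rcases hcases j hj' with h | rfl
    · simp only [hb j h, hb (j - 1) (by omega), hd2 j h, hd2 (j - 1) (by omega)]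
      rw [add_comm 1 j, e_mul_prefixTwo_mul_e (by omega) (by omega), div_self two_ne_zero,
        one_smul, show j + 1 - 1 = j - 1 + 1 by omega]
    -- At the top node the dimension drops from two to one, which is the factor `1/2`.
    · simp only [htop, hb (n - 1 - 1) (by omega), hd1, hd2 (n - 1 - 1) (by omega)]
      rw [show 1 + (n - 1) = n by omega] at hjN ⊢
      rw [e_mul_prefixOne_mul_e (by omega) hjN, show n - 1 - 1 + 1 = n - 1 by omega]
  · rw [htop, hb', prefixOne_add, hlast, prefixTwo_mul_e_mul (by omega) (by omega),
      show n - 1 + 1 = n by omega]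
    abel
  · rw [hd1, hd2 _ (by omega), div_one, htop]
    exact prefixOne_mul_e_mul hn h h11
  · rw [hb j (by omega), hb']
    exact ⟨prefixTwo_mul_prefixOne (by omega) (by omega) hN _,
          prefixOne_mul_prefixTwo (by omega) (by omega) hN _⟩
  · rw [hb', prefixOne_idem (by omega) hN hmm]
  · rw [htop, hb']
    exact horth _ _ (by norm_num) (by norm_num)
  · rw [htop, hb']
    exact horth _ _ (by norm_num) (by norm_num)
  · rw [hb', hlast, e_mul_prefixOne_mul_e (by omega) h]
  · rw [hb']
    exact e_mul_prefixOne hi hi' hN _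
  · rw [hb']
    exact e_comm_prefixOne hi hi' _
  · rw [htop]
    exact prefixOne_mul_e_mul hn h h11
  · rw [hb']
    exact prefixOne_mul_e_mul hn h hmm

end


section


variable {k : ℕ}

/-! ### Weights of modified sequences and elements of the centralizer algebras -/

theorem wt_comp_perm (t : Fin k → Fin 2) (σ : Equiv.Perm (Fin k)) : wt (t ∘ σ) = wt t :=
  Equiv.sum_comp σ fun i => (t i).val

/-- The weight changes by `j * (α - β)`; the additive form avoids subtraction of natural numbers. -/
theorem wt_rep {j : ℕ} (hj : j ≤ k) {α β : Fin 2} {t : Fin k → Fin 2} (ht : Pre j β t) :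
    wt (rep j α t) + j * β.val = wt t + j * α.val := by
  have hc (a : Fin 2) : ∑ i : Fin k, (if i.val < j then a.val else 0) = j * a.val := by
    rw [Fin.sum_univ_eq_sum_range (fun i => if i < j then a.val else 0), ← Finset.sum_filter]
    rw [Finset.sum_const, smul_eq_mul]
    congr 1
    rw [show (Finset.range k).filter (· < j) = Finset.range j by ext; simp; omega,
      Finset.card_range]
  rw [← hc, ← hc, wt, wt, ← Finset.sum_add_distrib, ← Finset.sum_add_distrib]
  refine Finset.sum_congr rfl fun i _ => ?_
  simp only [rep]
  split_ifs with h
  · rw [ht i h, add_comm]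
  · rfl

theorem flip_rep (j : ℕ) (α : Fin 2) (t : Fin k → Fin 2) :
    flip (rep j α t) = rep j (1 - α) (flip t) := by
  funext i
  simp only [flip, rep]
  split_ifs <;> rfl

theorem pre_flip {j : ℕ} {β : Fin 2} {t : Fin k → Fin 2} :
    Pre j (1 - β) (flip t) ↔ Pre j β t :=
  forall₂_congr fun i _ => by simp [flip]

theorem gMat_mul_perm (ζ : Circle) (σ : Equiv.Perm (Fin k)) :
    tensorAction k (gMat ζ) * perm σ = perm σ * tensorAction k (gMat ζ) :=
  end_ext fun t => by
    rw [Module.End.mul_apply, Module.End.mul_apply, perm_vec, gMat_vec, gMat_vec, map_smul,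
      perm_vec, wt_comp_perm]

theorem hMat_mul_perm (σ : Equiv.Perm (Fin k)) :
    tensorAction k hMat * perm σ = perm σ * tensorAction k hMat :=
  end_ext fun t => by
    rw [Module.End.mul_apply, Module.End.mul_apply, perm_vec, hMat_vec, hMat_vec, map_smul,
      perm_vec]
    rfl

theorem gMat_mul_prefixUnit {ζ : Circle} {D : ℕ} (hD : HasDiam ζ D) {j : ℕ} (hj : j ≤ k)
    {α β : Fin 2} (h : D ∣ j ∨ α = β) :
    tensorAction k (gMat ζ) * prefixUnit k j α β = prefixUnit k j α β * tensorAction k (gMat ζ) :=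
  end_ext fun t => by
    rw [Module.End.mul_apply, Module.End.mul_apply, gMat_vec, map_smul, prefixUnit_vec hj]
    split_ifs with ht
    · have hw := wt_rep (α := α) hj ht
      rw [gMat_vec, (hD.zpow_eq (wt (rep j α t)) (wt t) k).2]
      rcases h with h | rfl
      · have : (wt (rep j α t) : ℤ) - wt t = j * ((α.val : ℤ) - β.val) := by
          push_cast [← @Nat.cast_inj ℤ] at hw
          linear_combination hw
        rw [this]
        exact (Int.natCast_dvd_natCast.2 h).mul_right _
      · rw [show wt (rep j α t) = wt t by omega, sub_self]
        exact dvd_zero _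
    · simp

theorem hMat_mul_prefixUnit {j : ℕ} (hj : j ≤ k) (α β : Fin 2) :
    tensorAction k hMat * prefixUnit k j α β =
      prefixUnit k j (1 - α) (1 - β) * tensorAction k hMat :=
  end_ext fun t => by
    rw [Module.End.mul_apply, Module.End.mul_apply, hMat_vec, map_smul, prefixUnit_vec hj,
      prefixUnit_vec hj]
    simp only [pre_flip]
    split_ifs
    · rw [hMat_vec, flip_rep]
    · simp

theorem commute_e {x : Module.End ℂ (TPow k)} (h : ∀ σ, x * perm σ = perm σ * x) (i : ℕ) :
    x * e k i = e k i * x := by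
  by_cases hi : 1 ≤ i ∧ i < k
  · rw [e_eq hi.1 hi.2, end_mul_sub, end_sub_mul, h, mul_one, one_mul]
  · rw [e, dif_neg hi, mul_zero, zero_mul]

/-! ### Subalgebras that contain the permutations of the tensor factors -/

/-- The projection onto the span of the `v_t` with property `p`. -/
def diagOp (p : (Fin k → Fin 2) → Prop) : Module.End ℂ (TPow k) :=
  open Classical in (vecBasis k).constr ℂ fun t => if p t then vec t else 0

open Classical in
theorem diagOp_vec (p : (Fin k → Fin 2) → Prop) (t : Fin k → Fin 2) :
    diagOp p (vec t) = if p t then vec t else 0 := by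
  rw [diagOp, ← vecBasis_apply, Module.Basis.constr_basis, vecBasis_apply]

theorem diagOp_mul (p q : (Fin k → Fin 2) → Prop) :
    diagOp p * diagOp q = diagOp fun t => q t ∧ p t :=
  end_ext fun t => by
    rw [Module.End.mul_apply, diagOp_vec, diagOp_vec (fun t => q t ∧ p t)]
    by_cases h : q t
    · rw [if_pos h, diagOp_vec]
      by_cases h' : p t
      · rw [if_pos h', if_pos ⟨h, h'⟩]
      · rw [if_neg h', if_neg fun H => h' H.2]
    · rw [if_neg h, if_neg fun H => h H.1, map_zero]

theorem perm_mul_diagOp_mul (σ : Equiv.Perm (Fin k)) (p : (Fin k → Fin 2) → Prop) :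
    perm σ * diagOp p * perm σ⁻¹ = diagOp fun t => p (t ∘ σ) :=
  end_ext fun t => by
    rw [Module.End.mul_apply, Module.End.mul_apply, perm_vec, diagOp_vec, diagOp_vec,
      Equiv.Perm.inv_def, Equiv.symm_symm]
    split_ifs
    · rw [perm_vec, Function.comp_assoc]; simp
    · simp

variable {A : Subalgebra ℂ (Module.End ℂ (TPow k))}

theorem diagOp_forall_mem {p : Fin k → (Fin k → Fin 2) → Prop} (h : ∀ i, diagOp (p i) ∈ A) :
    diagOp (fun t => ∀ i, p i t) ∈ A := by
  have (s : Finset (Fin k)) : diagOp (fun t => ∀ i ∈ s, p i t) ∈ A := by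
    induction s using Finset.induction_on with
    | empty =>
      convert A.one_mem using 1
      exact end_ext fun t => by rw [diagOp_vec]; simp
    | insert i s _ ih =>
      convert A.mul_mem ih (h i) using 1
      rw [diagOp_mul]
      congr 1
      funext t
      simp
  simpa using this Finset.univ

theorem end_sub_mem {a b : Module.End ℂ (TPow k)} (ha : a ∈ A) (hb : b ∈ A) : a - b ∈ A := by
  convert A.add_mem ha (A.smul_mem hb (-1)) using 1
  exact LinearMap.ext fun x => by
    rw [LinearMap.sub_apply, LinearMap.add_apply, LinearMap.smul_apply, neg_one_smul,
      sub_eq_add_neg]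

/-- Since `s_i = 1 - e_i`, the algebra contains the adjacent transpositions, which generate the
symmetric group. -/
theorem perm_mem (h : ∀ i, 1 ≤ i → i < k → e k i ∈ A) (σ : Equiv.Perm (Fin k)) : perm σ ∈ A := by
  rcases k with _ | k
  · rw [Subsingleton.elim σ 1, perm_one]; exact A.one_mem
  · have hσ : σ ∈ Submonoid.closure
        (Set.range fun i : Fin k => Equiv.swap i.castSucc i.succ) := by
      rw [Equiv.Perm.mclosure_swap_castSucc_succ]; trivial
    induction hσ using Submonoid.closure_induction with
    | mem σ hσ =>
      obtain ⟨i, rfl⟩ := hσ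
      have := end_sub_mem A.one_mem (h (i + 1) (by omega) (by omega))
      rw [e_eq (by omega) (by omega)] at this
      convert this using 1
      change _ = 1 - (1 - perm (Equiv.swap i.castSucc i.succ))
      abel
    | one => rw [perm_one]; exact A.one_mem
    | mul σ τ _ _ h1 h2 => rw [perm_mul]; exact A.mul_mem h1 h2

/-- Equal weight means equally many positions with entry `1`; a bijection between these positions
extends to a permutation. -/
theorem exists_perm_of_wt_eq {r s : Fin k → Fin 2} (h : wt r = wt s) :
    ∃ σ : Equiv.Perm (Fin k), r = s ∘ σ := by
  have hcard (t : Fin k → Fin 2) : Fintype.card {i // t i = 1} = wt t := by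
    rw [Fintype.card_subtype, wt, Finset.card_filter]
    refine Finset.sum_congr rfl fun i _ => ?_
    have : t i = 0 ∨ t i = 1 := by omega
    rcases this with h | h <;> simp [h]
  let f : {i // r i = 1} ≃ {i // s i = 1} :=
    Fintype.equivOfCardEq (by rw [hcard, hcard, h])
  refine ⟨f.extendSubtype, funext fun i => ?_⟩
  by_cases hi : r i = 1
  · exact hi.trans (f.extendSubtype_mem i hi).symm
  · have : s (f.extendSubtype i) ≠ 1 := f.extendSubtype_not_mem i hi
    simp only [Function.comp]
    omega

/-- A transitive relation on sequences of signs that relates sequences of equal weight, and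
sequences that differ in the first `D` entries by a change of sign, relates all sequences whose
weights agree modulo `D`. -/
theorem rel_of_dvd_wt_sub {D : ℕ} {R : (Fin k → Fin 2) → (Fin k → Fin 2) → Prop}
    (htrans : ∀ r s t, R r s → R s t → R r t) (heq : ∀ r s, wt r = wt s → R r s)
    (hstep : ∀ t, Pre D 0 t → R (rep D 1 t) t ∧ R t (rep D 1 t)) {r s : Fin k → Fin 2}
    (h : (D : ℤ) ∣ (wt r : ℤ) - wt s) : R r s := by
  have main (m : ℕ) : ∀ r s, wt r = wt s + D * m → R r s ∧ R s r := by
    induction m with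
    | zero => exact fun r s h => ⟨heq _ _ (by simpa using h), heq _ _ (by simpa using h.symm)⟩
    | succ m ih =>
      intro r s hrs
      rw [mul_add, mul_one] at hrs
      have hr := wt_le r
      have hDk : wt s + D ≤ k := by
        have := Nat.zero_le (D * m); omega
      -- The intermediate sequence consists of `k - wt s` zeros followed by ones. It has the weight
      -- of `s`, and its first `D` entries are zero because `wt s + D ≤ k`; changing them to ones
      -- raises the weight by `D`.
      have hp : Pre (k - wt s) 1 (fun _ : Fin k => (1 : Fin 2)) := fun _ _ => rfl
      have hw := wt_rep (α := 0) (Nat.sub_le _ _) hp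
      rw [wt_const] at hw
      simp at hw
      have ht : Pre D 0 (rep (k - wt s) 0 fun _ : Fin k => (1 : Fin 2)) := by
        intro i hi
        simp only [rep]
        rw [if_pos (by omega)]
      have hq := wt_rep (α := 1) (show D ≤ k by omega) ht
      simp at hq
      obtain ⟨h1, h2⟩ := hstep _ ht
      obtain ⟨h3, h4⟩ := ih r _ (show wt r = wt (rep D 1 (rep (k - wt s) 0 fun _ => 1)) + D * m by
        omega)
      exact ⟨htrans _ _ _ h3 (htrans _ _ _ h1 (heq _ _ (by omega))),
        htrans _ _ _ (heq _ _ (by omega)) (htrans _ _ _ h2 h4)⟩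
  obtain ⟨c, hc⟩ := h
  rcases Int.le_total 0 c with h0 | h0
  · lift c to ℕ using h0
    exact (main c r s (by zify; linear_combination hc)).1
  · obtain ⟨m, rfl⟩ : ∃ m : ℕ, c = -m := ⟨(-c).toNat, by omega⟩
    exact (main m s r (by zify; linear_combination -hc)).2

/-! ### Expansion of endomorphisms in matrix units -/

theorem eq_sum_matUnit (f : Module.End ℂ (TPow k)) :
    f = ∑ s, ∑ r, (vecBasis k).repr (f (vec s)) r • matUnit r s := by
  refine end_ext fun t => ?_
  simp only [LinearMap.sum_apply, LinearMap.smul_apply, matUnit_vec, smul_ite, smul_zero]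
  simp only [Finset.sum_ite_irrel, Finset.sum_const_zero, Finset.sum_ite_eq, Finset.mem_univ,
    if_true]
  conv_lhs => rw [← (vecBasis k).sum_repr (f (vec t))]
  simp

theorem perm_mul_matUnit (σ : Equiv.Perm (Fin k)) (r s : Fin k → Fin 2) :
    perm σ * matUnit r s = matUnit (r ∘ σ.symm) s :=
  end_ext fun t => by
    rw [Module.End.mul_apply, matUnit_vec, matUnit_vec]
    split_ifs
    · rw [perm_vec]
    · simp

theorem prefixUnit_mul_matUnit {D : ℕ} (hD : D ≤ k) (α β : Fin 2) (r s : Fin k → Fin 2) :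
    prefixUnit k D α β * matUnit r s = if Pre D β r then matUnit (rep D α r) s else 0 :=
  end_ext fun t => by
    rw [Module.End.mul_apply, matUnit_vec]
    by_cases h : t = s
    · rw [if_pos h, prefixUnit_vec hD]
      split_ifs
      · rw [matUnit_vec, if_pos h]
      · rfl
    · rw [if_neg h, map_zero]
      split_ifs
      · rw [matUnit_vec, if_neg h]
      · rfl

/-! ### Generation in the cyclic case -/

theorem centralizer_cyclic_le {ζ : Circle} {D : ℕ} (hD : HasDiam ζ D) (hD1 : 1 ≤ D) (hDk : D ≤ k)
    (he : ∀ i, 1 ≤ i → i < k → e k i ∈ A) (h1 : ∀ s, prefixUnit k 1 s s ∈ A)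
    (htop : ∀ α β, α ≠ β → prefixUnit k D α β ∈ A) :
    centralizerAlgebra (cyclicGroup ζ) k ≤ A := by
  have hperm := perm_mem he
  -- The projection fixing the sign of the first entry is carried to position `i` by conjugation
  -- with a transposition.
  have hsite (i : Fin k) (a : Fin 2) : diagOp (fun t => t i = a) ∈ A := by
    have h := A.mul_mem (A.mul_mem (hperm (Equiv.swap ⟨0, by omega⟩ i)) (h1 a))
      (hperm (Equiv.swap ⟨0, by omega⟩ i)⁻¹)
    have h' : prefixUnit k 1 a a = diagOp fun t => t ⟨0, by omega⟩ = a := end_ext fun t => by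
      rw [prefixUnit_vec (by omega), diagOp_vec]
      have hp : Pre 1 a t ↔ t ⟨0, by omega⟩ = a :=
        ⟨fun H => H _ zero_lt_one, fun H x hx => by
          rw [← H, show x = ⟨0, by omega⟩ from Fin.ext (show x.val = 0 by omega)]⟩
      by_cases ht : Pre 1 a t
      · rw [if_pos ht, if_pos (hp.1 ht), rep_of_pre ht]
      · rw [if_neg ht, if_neg (mt hp.2 ht)]
    rw [h', perm_mul_diagOp_mul] at h
    simpa using h
  -- Prescribing every entry leaves the single sequence `r`.
  have hdiag (r : Fin k → Fin 2) : matUnit r r ∈ A := by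
    convert diagOp_forall_mem fun i => hsite i (r i) using 1
    refine end_ext fun t => ?_
    rw [diagOp_vec, matUnit_vec]
    simp only [← funext_iff]
    split_ifs with h
    · rw [h]
    · rfl
  have hR {r s : Fin k → Fin 2} (h : (D : ℤ) ∣ (wt r : ℤ) - wt s) : matUnit r s ∈ A := by
    refine rel_of_dvd_wt_sub (R := fun r s => matUnit r s ∈ A) (fun r s t h1 h2 => ?_)
      (fun r s h => ?_) (fun t ht => ⟨?_, ?_⟩) h
    · simpa [matUnit_mul] using A.mul_mem h1 h2
    · obtain ⟨σ, rfl⟩ := exists_perm_of_wt_eq h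
      simpa [perm_mul_matUnit] using A.mul_mem (hperm σ.symm) (hdiag s)
    · have := A.mul_mem (htop 1 0 one_ne_zero) (hdiag t)
      rwa [prefixUnit_mul_matUnit hDk, if_pos ht] at this
    · have := A.mul_mem (htop 0 1 zero_ne_one) (hdiag (rep D 1 t))
      rwa [prefixUnit_mul_matUnit hDk, if_pos ((pre_rep hD1 le_rfl hDk _ _ _).2 rfl),
        rep_rep le_rfl, rep_of_pre ht] at this
  intro f hf
  rw [eq_sum_matUnit f]
  refine A.sum_mem fun s _ => A.sum_mem fun r _ => ?_
  by_cases hne : (vecBasis k).repr (f (vec s)) r = 0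
  · rw [hne, zero_smul]; exact A.zero_mem
  · exact A.smul_mem (hR (hD.dvd_of_commute (mem_centralizer_cyclic.1 hf) hne)) _

/-! ### Generation in the binary dihedral case -/

/-- The sum of the matrix unit `E_{r,s}` and the matrix unit of the opposite sequences. -/
def symUnit (r s : Fin k → Fin 2) : Module.End ℂ (TPow k) :=
  matUnit r s + matUnit (flip r) (flip s)

theorem ne_flip (hk : 1 ≤ k) (t : Fin k → Fin 2) : t ≠ flip t := by
  intro h
  have := congrFun h ⟨0, hk⟩
  simp only [flip] at this
  omega

theorem symUnit_mul (hk : 1 ≤ k) (r s t : Fin k → Fin 2) :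
    symUnit r s * symUnit s t = symUnit r t := by
  simp [symUnit, mul_add, add_mul, matUnit_mul, ne_flip hk, (ne_flip hk _).symm]

theorem perm_mul_symUnit (σ : Equiv.Perm (Fin k)) (r s : Fin k → Fin 2) :
    perm σ * symUnit r s = symUnit (r ∘ σ.symm) s := by
  rw [symUnit, mul_add, perm_mul_matUnit, perm_mul_matUnit]; rfl

/-- `flip t` begins with the sign opposite to `β`, so each of the two prefix units acts on exactly
one summand of `symUnit t s`, and the images are again flips of each other. -/
theorem prefix_mul_symUnit {D : ℕ} (hD1 : 1 ≤ D) (hD : D ≤ k) {α β : Fin 2} (hαβ : α ≠ β)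
    {t : Fin k → Fin 2} (ht : Pre D β t) (s : Fin k → Fin 2) :
    (prefixUnit k D 0 1 + prefixUnit k D 1 0) * symUnit t s = symUnit (rep D α t) s := by
  have hfl := pre_flip.2 ht
  have hn {a b : Fin 2} {t : Fin k → Fin 2} (h : Pre D a t) (hab : a ≠ b) : ¬ Pre D b t :=
    fun H => hab (h.eq hD1 hD H)
  have : (α = 0 ∧ β = 1) ∨ (α = 1 ∧ β = 0) := by omega
  rcases this with ⟨rfl, rfl⟩ | ⟨rfl, rfl⟩
  · rw [sub_self] at hfl
    simp [symUnit, mul_add, add_mul, prefixUnit_mul_matUnit hD, ht, hfl, hn ht one_ne_zero,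
      hn hfl zero_ne_one, flip_rep]
  · rw [sub_zero] at hfl
    simp [symUnit, mul_add, add_mul, prefixUnit_mul_matUnit hD, ht, hfl, hn hfl one_ne_zero,
      hn ht zero_ne_one, flip_rep]

theorem repr_flip_of_commute {f : Module.End ℂ (TPow k)}
    (hf : tensorAction k hMat * f = f * tensorAction k hMat) (r s : Fin k → Fin 2) :
    (vecBasis k).repr (f (vec (flip s))) (flip r) = (vecBasis k).repr (f (vec s)) r := by
  have h := congrArg (fun x => (vecBasis k).repr x (flip r)) (LinearMap.congr_fun hf (vec s))
  simp only [Module.End.mul_apply, repr_hMat, hMat_vec, map_smul, Finsupp.smul_apply, smul_eq_mul,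
    flip_flip] at h
  exact (mul_left_cancel₀ (pow_ne_zero _ Complex.I_ne_zero) h).symm

/-- Commuting with `h` makes the matrix entries invariant under simultaneous flips, so `f` is the
average of its expansion and the flipped expansion. -/
theorem eq_sum_symUnit {f : Module.End ℂ (TPow k)}
    (hf : tensorAction k hMat * f = f * tensorAction k hMat) :
    f = (1 / 2 : ℂ) • ∑ s, ∑ r, (vecBasis k).repr (f (vec s)) r • symUnit r s := by
  let F : Equiv.Perm (Fin k → Fin 2) := ⟨flip, flip, flip_flip, flip_flip⟩
  have h : f = ∑ s, ∑ r, (vecBasis k).repr (f (vec s)) r • matUnit (flip r) (flip s) := by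
    conv_lhs => rw [eq_sum_matUnit f, ← Equiv.sum_comp F]
    refine Finset.sum_congr rfl fun s _ => ?_
    rw [← Equiv.sum_comp F]
    refine Finset.sum_congr rfl fun r _ => ?_
    change (vecBasis k).repr (f (vec (flip s))) (flip r) • matUnit (flip r) (flip s) = _
    rw [repr_flip_of_commute hf]
  simp only [symUnit, smul_add, Finset.sum_add_distrib]
  rw [← smul_add, ← h, ← eq_sum_matUnit f]
  module

theorem centralizer_dihedral_le {ζ : Circle} {D : ℕ} (hD : HasDiam ζ D) (hD2 : 2 ≤ D)
    (hDk : D ≤ k) (he : ∀ i, 1 ≤ i → i < k → e k i ∈ A) (h2 : prefixTwo k 2 ∈ A)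
    (htop : prefixUnit k D 0 1 + prefixUnit k D 1 0 ∈ A) :
    centralizerAlgebra (dihedralGroup ζ) k ≤ A := by
  have hk : 1 ≤ k := by omega
  have hperm := perm_mem he
  -- `prefixTwo k 2` projects onto the sequences whose first two entries agree. Conjugation with a
  -- transposition fixing the first position replaces the second position by `i`.
  have hpair (i : Fin k) : diagOp (fun t => t i = t ⟨0, hk⟩) ∈ A := by
    by_cases hi : i = ⟨0, hk⟩
    · convert A.one_mem using 1
      exact end_ext fun t => by rw [diagOp_vec, if_pos (by rw [hi])]; rfl
    have h := A.mul_mem (A.mul_mem (hperm (Equiv.swap ⟨1, by omega⟩ i)) h2)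
      (hperm (Equiv.swap ⟨1, by omega⟩ i)⁻¹)
    have h' : prefixTwo k 2 = diagOp fun t => t ⟨1, by omega⟩ = t ⟨0, hk⟩ := end_ext fun t => by
      have hp (a : Fin 2) : Pre 2 a t ↔ t ⟨0, hk⟩ = a ∧ t ⟨1, by omega⟩ = a := by
        refine (pre_succ (j := 1) (by omega) a t).trans (and_congr_left fun _ => ?_)
        exact (pre_succ (j := 0) (by omega) a t).trans (by simp [Pre])
      have hr (a : Fin 2) : (if Pre 2 a t then vec (rep 2 a t) else 0) =
          if Pre 2 a t then vec t else 0 := by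
        split_ifs with H
        · rw [rep_of_pre H]
        · rfl
      rw [prefixTwo, LinearMap.add_apply, prefixUnit_vec (by omega), prefixUnit_vec (by omega),
        diagOp_vec, hr, hr]
      simp only [hp]
      have h0 : t ⟨0, hk⟩ = 0 ∨ t ⟨0, hk⟩ = 1 := by omega
      have h1 : t ⟨1, by omega⟩ = 0 ∨ t ⟨1, by omega⟩ = 1 := by omega
      rcases h0 with h0 | h0 <;> rcases h1 with h1 | h1 <;> simp [h0, h1]
    rw [h', perm_mul_diagOp_mul] at h
    have h0 : Equiv.swap (⟨1, by omega⟩ : Fin k) i ⟨0, hk⟩ = ⟨0, hk⟩ :=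
      Equiv.swap_apply_of_ne_of_ne (by simp) (Ne.symm hi)
    simpa [h0] using h
  have hpair' (i : Fin k) (c : Prop) : diagOp (fun t => t i = t ⟨0, hk⟩ ↔ c) ∈ A := by
    by_cases hc : c
    · simpa [hc] using hpair i
    · convert end_sub_mem A.one_mem (hpair i) using 1
      refine end_ext fun t => ?_
      rw [LinearMap.sub_apply, diagOp_vec, diagOp_vec]
      by_cases h : t i = t ⟨0, hk⟩ <;> simp [h, hc]
  -- Prescribing which entries agree with the first one determines a sequence up to a global flip,
  -- leaving `r` and `flip r`.
  have hdiag (r : Fin k → Fin 2) : symUnit r r ∈ A := by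
    convert diagOp_forall_mem fun i => hpair' i (r i = r ⟨0, hk⟩) using 1
    refine end_ext fun t => ?_
    rw [diagOp_vec, symUnit, LinearMap.add_apply, matUnit_vec, matUnit_vec]
    by_cases h : t = r
    · subst h
      simp [ne_flip hk]
    · by_cases h' : t = flip r
      · subst h'
        simp [(ne_flip hk r).symm, flip]
      · rw [if_neg h, if_neg h', if_neg, add_zero]
        intro H
        by_cases h0 : t ⟨0, hk⟩ = r ⟨0, hk⟩
        · exact h (funext fun i => by have := H i; omega)
        · exact h' (funext fun i => by have := H i; simp only [flip]; omega)
  have hR {r s : Fin k → Fin 2} (h : (D : ℤ) ∣ (wt r : ℤ) - wt s) : symUnit r s ∈ A := by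
    refine rel_of_dvd_wt_sub (R := fun r s => symUnit r s ∈ A) (fun r s t h1 h2 => ?_)
      (fun r s h => ?_) (fun t ht => ⟨?_, ?_⟩) h
    · simpa [symUnit_mul hk] using A.mul_mem h1 h2
    · obtain ⟨σ, rfl⟩ := exists_perm_of_wt_eq h
      simpa [perm_mul_symUnit] using A.mul_mem (hperm σ.symm) (hdiag s)
    · have := A.mul_mem htop (hdiag t)
      rwa [prefix_mul_symUnit (by omega) hDk one_ne_zero ht] at this
    · have := A.mul_mem htop (hdiag (rep D 1 t))
      rwa [prefix_mul_symUnit (by omega) hDk zero_ne_one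
        ((pre_rep (by omega) le_rfl hDk _ _ _).2 rfl), rep_rep le_rfl, rep_of_pre ht] at this
  intro f hf
  rw [mem_centralizer_dihedral] at hf
  rw [eq_sum_symUnit hf.2]
  refine A.smul_mem (A.sum_mem fun s _ => A.sum_mem fun r _ => ?_) _
  by_cases hne : (vecBasis k).repr (f (vec s)) r = 0
  · rw [hne, zero_smul]; exact A.zero_mem
  · exact A.smul_mem (hR (hD.dvd_of_commute hf.1 hne)) _

end


/-! ### The two families -/

theorem adjoin_cyclicGenerators {n k : ℕ} (hn : 1 ≤ n) {ζ : Circle}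
    (hD : HasDiam ζ (cycDiam n)) (hk : cycDiam n ≤ k)
    {b : (j : ℕ) → Fin 2 → Module.End ℂ (TPow j)}
    (hb : ∀ j s, j ≤ cycDiam n → b j s = matUnit (fun _ => s) (fun _ => s)) :
    Algebra.adjoin ℂ (cyclicGenerators n k b) = centralizerAlgebra (cyclicGroup ζ) k := by
  have hD1 := cycDiam_pos hn
  have hU (j : ℕ) (s : Fin 2) (hj : j ≤ cycDiam n) : emb k (b j s) = prefixUnit k j s s := by
    rw [hb j s hj, prefixUnit]
  have hC := cycUnit_eq (N := k) fun s => hb (cycDiam n) s le_rfl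
  refine le_antisymm (Algebra.adjoin_le ?_) (centralizer_cyclic_le hD hD1 hk
    (fun i h1 h2 => ?_) (fun s => ?_) (fun α β h => ?_))
  · rintro x ((⟨i, -, -, rfl⟩ | ⟨j, s, -, hj, rfl⟩) | ⟨δ, γ, -, rfl⟩) <;>
      refine mem_centralizer_cyclic.2 ?_
    · exact commute_e (gMat_mul_perm ζ) i
    · rw [hU j s hj]
      exact gMat_mul_prefixUnit hD (hj.trans hk) (Or.inr rfl)
    · rw [hC]
      exact gMat_mul_prefixUnit hD hk (Or.inl dvd_rfl)
  · exact Algebra.subset_adjoin (Or.inl (Or.inl ⟨i, h1, h2, rfl⟩))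
  · exact Algebra.subset_adjoin (Or.inl (Or.inr ⟨1, s, le_rfl, hD1, (hU 1 s hD1).symm⟩))
  · exact Algebra.subset_adjoin (Or.inr ⟨α, β, h, (hC α β).symm⟩)

theorem IsDihedralFamily.emb_eq {n N : ℕ} (hn : 1 ≤ n) {ζ : Circle}
    (hζ : IsPrimitiveRoot ζ (2 * n)) {b : (j : ℕ) → Module.End ℂ (TPow (j + 1))}
    {b' : Module.End ℂ (TPow n)} (hb : IsDihedralFamily n ζ b b') :
    (∀ j, j + 1 < n → emb N (b j) = prefixTwo N (j + 1)) ∧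
      emb N (b (n - 1)) = prefixOne N n 1 ∧ emb N b' = prefixOne N n (-1) := by
  refine ⟨fun j hj => ?_, ?_, ?_⟩
  · rw [eq_twoProj (hasDiam_dihedral hζ) (by omega) hj (hb.proj j hj), emb_twoProj]
  · obtain ⟨m, rfl⟩ : ∃ m, n = m + 1 := ⟨n - 1, by omega⟩
    rw [Nat.add_sub_cancel, eq_oneProj (ε := 1) hn hζ (one_mul 1) (f := b m)
      (by simpa using hb.top m rfl), emb_oneProj]
  · rw [eq_oneProj (ε := -1) hn hζ (by norm_num) (f := b') (by simpa using hb.prime), emb_oneProj]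

theorem mem_centralizer_prefixTwo {ζ : Circle} {D k j : ℕ} (hD : HasDiam ζ D) (hj : j ≤ k) :
    prefixTwo k j ∈ centralizerAlgebra (dihedralGroup ζ) k := by
  refine mem_centralizer_dihedral.2 ⟨?_, ?_⟩
  · simp only [prefixTwo, mul_add, add_mul, gMat_mul_prefixUnit hD hj (Or.inr rfl)]
  · simp only [prefixTwo, mul_add, add_mul, hMat_mul_prefixUnit hj, sub_zero, sub_self]
    exact add_comm _ _

theorem mem_centralizer_prefixOne {ζ : Circle} {D k : ℕ} (hD : HasDiam ζ D) (hk : D ≤ k) (ε : ℂ) :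
    prefixOne k D ε ∈ centralizerAlgebra (dihedralGroup ζ) k := by
  refine Subalgebra.smul_mem _ (Subalgebra.add_mem _ (mem_centralizer_prefixTwo hD hk)
    (Subalgebra.smul_mem _ (mem_centralizer_dihedral.2 ⟨?_, ?_⟩) _)) _
  · simp only [mul_add, add_mul, gMat_mul_prefixUnit hD hk (Or.inl dvd_rfl)]
  · simp only [mul_add, add_mul, hMat_mul_prefixUnit hk, sub_zero, sub_self]
    exact add_comm _ _

theorem adjoin_dihedralGenerators {n k : ℕ} (hn : 2 ≤ n) {ζ : Circle} (hD : HasDiam ζ n)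
    (hk : n ≤ k) {b : (j : ℕ) → Module.End ℂ (TPow (j + 1))} {b' : Module.End ℂ (TPow n)}
    (hb : ∀ j, j + 1 < n → emb k (b j) = prefixTwo k (j + 1))
    (htop : emb k (b (n - 1)) = prefixOne k n 1) (hb' : emb k b' = prefixOne k n (-1)) :
    Algebra.adjoin ℂ (dihedralGenerators n k b b') = centralizerAlgebra (dihedralGroup ζ) k := by
  have hone : prefixOne k n 1 ∈ Algebra.adjoin ℂ (dihedralGenerators n k b b') :=
    Algebra.subset_adjoin (Or.inl (Or.inr ⟨n - 1, by omega, by omega, htop.symm⟩))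
  have hneg : prefixOne k n (-1) ∈ Algebra.adjoin ℂ (dihedralGenerators n k b b') :=
    Algebra.subset_adjoin (Or.inr hb'.symm)
  refine le_antisymm (Algebra.adjoin_le ?_) (centralizer_dihedral_le hD hn hk
    (fun i h1 h2 => ?_) ?_ ?_)
  · rintro x ((⟨i, -, -, rfl⟩ | ⟨j, -, hj, rfl⟩) | rfl)
    · exact mem_centralizer_dihedral.2
        ⟨commute_e (gMat_mul_perm ζ) i, commute_e hMat_mul_perm i⟩
    · rcases (show j + 1 < n ∨ j = n - 1 by omega) with h | rfl
      · rw [hb j h]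
        exact mem_centralizer_prefixTwo hD (by omega)
      · rw [htop]
        exact mem_centralizer_prefixOne hD hk 1
    · rw [hb']
      exact mem_centralizer_prefixOne hD hk (-1)
  · exact Algebra.subset_adjoin (Or.inl (Or.inl ⟨i, h1, h2, rfl⟩))
  -- For `n ≥ 3` this projection is `b_1`; for `n = 2` it splits as `b_1 + b'`.
  · rcases hn.lt_or_eq with h | rfl
    · exact Algebra.subset_adjoin (Or.inl (Or.inr ⟨1, le_rfl, by omega, (hb 1 h).symm⟩))
    · rw [← prefixOne_add]
      exact Subalgebra.add_mem _ hone hneg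
  -- The off-diagonal part is the difference `b_{n-1} - b'`.
  · convert Subalgebra.add_mem _ hone (Subalgebra.smul_mem _ hneg (-1)) using 1
    rw [prefixOne, prefixOne]
    module

end

end McKay


theorem mainTheorem8 :
    (∀ (n : ℕ) (ζ : Circle), 1 ≤ n → IsPrimitiveRoot ζ n →
      (∃ b : (j : ℕ) → Fin 2 → Module.End ℂ (McKay.TPow j), McKay.IsCyclicFamily n ζ b) ∧
      ∀ b : (j : ℕ) → Fin 2 → Module.End ℂ (McKay.TPow j), McKay.IsCyclicFamily n ζ b →
        ∀ k : ℕ, McKay.cycDiam n ≤ k →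
          Algebra.adjoin ℂ (McKay.cyclicGenerators n k b) =
            McKay.centralizerAlgebra (McKay.cyclicGroup ζ) k ∧
          ∀ N : ℕ, k ≤ N → McKay.CyclicRelations n N b) ∧
    (∀ (n : ℕ) (ζ : Circle), 2 ≤ n → IsPrimitiveRoot ζ (2 * n) →
      (∃ (b : (j : ℕ) → Module.End ℂ (McKay.TPow (j + 1))) (b' : Module.End ℂ (McKay.TPow n)),
        McKay.IsDihedralFamily n ζ b b') ∧
      ∀ (b : (j : ℕ) → Module.End ℂ (McKay.TPow (j + 1))) (b' : Module.End ℂ (McKay.TPow n)),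
        McKay.IsDihedralFamily n ζ b b' → ∀ k : ℕ, n ≤ k →
          Algebra.adjoin ℂ (McKay.dihedralGenerators n k b b') =
            McKay.centralizerAlgebra (McKay.dihedralGroup ζ) k ∧
          ∀ N : ℕ, k ≤ N → McKay.DihedralRelations n N b b') := by
  refine ⟨fun n ζ hn hζ => ?_, fun n ζ hn hζ => ?_⟩
  · have hD := McKay.hasDiam_cyclic hζ
    refine ⟨⟨_, McKay.isCyclicFamily_matUnit hD⟩, fun b hb k hk => ?_⟩
    have hb' := fun j s (hj : j ≤ McKay.cycDiam n) => hb.eq_matUnit hD hj s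
    exact ⟨McKay.adjoin_cyclicGenerators hn hD hk hb',
      fun N hN => McKay.cyclicRelations hn (hk.trans hN) hb'⟩
  · refine ⟨McKay.exists_isDihedralFamily (by omega) hζ, fun b b' hb k hk => ?_⟩
    have h := fun N => hb.emb_eq (N := N) (by omega) hζ
    exact ⟨McKay.adjoin_dihedralGenerators hn (McKay.hasDiam_dihedral hζ) hk (h k).1 (h k).2.1
      (h k).2.2, fun N hN => McKay.dihedralRelations hn (hk.trans hN) (h N).1 (h N).2.1 (h N).2.2⟩
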